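/- **Setting.** Let $\mathbf J^2_N=\mathbb R\times\mathbb R^N\times \mathrm{Sym}^2(\mathbb R^N)$. A matrix $a\in \mathrm O_N$ acts on it by $a\cdot(r,p,A)=(r,\,ap,\,aAa^t)$. Let $G\subset \mathrm O_N$ be a subgroup. A *$G$-invariant universal subequation* is a closed subset $\mathbf F\subset\mathbf J^2_N$ such that 1. $\mathbf F+(\mathbb R_-\times\{0\}\times\mathcal P)\subset\mathbf F$, where $\mathbb R_-=(-\infty,0]$ and $\mathcal P=\{A\in \mathrm{Sym}^2(\mathbb R^N): A\ge 0\}$, 2. $\mathbf F=\overline{\mathrm{Int}\,\mathbf F}$ (in $\mathbf J^2_N$), 3. $\mathbf F$ is invariant under the action of $G$. Let $Z$ be a smooth Riemannian manifold of dimension $N$ with Levi-Civita connection $\nabla$ and Riemannian Hessian $(\mathrm{Hess}\,u)(V,W)=VWu-(\nabla_VW)u$. For a basis $e=(e_1,\dots,e_N)$ of $T_zZ$ and a function $u$ which is $C^2$ near $z$ put $[J_zu]_e=\big(u(z),\,(e_iu)_i,\,(\mathrm{Hess}_zu(e_i,e_j))_{ij}\big)\in\mathbf J^2_N$; this depends only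 on the 2-jet $J_zu\in J^2_z(Z)$. * If $\mathbf F$ is $\mathrm O_N$-invariant, the *subequation $F\subset J^2(Z)$ canonically determined by $\mathbf F$* is given by: $J_zu\in F_z$ if and only if $[J_zu]_e\in\mathbf F$ for any orthonormal basis $e$ of $T_zZ$ (by invariance the choice of $e$ does not matter). * A *topological $G$-structure* on $Z$ is a maximal family of smooth orthonormal frame fields ("admissible" framings), defined on open sets that cover $Z$, whose changes of framings on overlaps take values in $G$. If $Z$ has such a structure and $\mathbf F$ is $G$-invariant, the *subequation $F\subset J^2(Z)$ canonically determined by $\mathbf F$* is given by: $J_zu\in F_z$ if and only if $[J_zu]_{e(z)}\in\mathbf F$ for any admissible framing $e$ near $z$. Given $F\subset J^2(Z)$, an upper semi-continuous function $u:Z\to[-\infty,\infty)$ is *$F$-subharmonic* if $J_z\varphi\in F_z$ for every $z\in Z$ and every function $\varphi$, $C^2$ near $z$, with $u\le\varphi$ near $z$ and $u(z)=\varphi(z)$; likewise on other manifolds. Let $i:X\hookrightarrow Z$ be an embedded submanifold of dimension $n\leq N$. Let $H=i^*F\subset J^2(X)$ be the restriction of $F$, that is, $H_x=\{J_x(\varphi|_X):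 J_{i(x)}\varphi\in F_{i(x)}\}$, and let $\overline H$, with fibres $\overline{H_x}$, be its fibrewise closure. *Restriction to $X$ holds for $F$* if $u|_X$ is $H$-subharmonic on $X$ for each $F$-subharmonic $u$ on $Z$. Let $i^*\mathbf F\subset\mathbf J^2_n$ be the image of $\mathbf F$ under $(r,p,A)\mapsto\big(r,(p_a)_{a\le n},(A_{ab})_{a,b\le n}\big)$. The submanifold $X$ is *totally geodesic* if $\nabla_VW$ is tangent to $X$ for all vector fields $V,W$ tangent to $X$. It is a *$G$-submanifold* (of $Z$ with a topological $G$-structure) if near each point of $X$ there is an admissible framing $e$ such that, along $X$, $e_1,\dots,e_n$ are tangent to $X$ and $e_{n+1},\dots,e_N$ are normal to $X$. **Theorem.** Let $X\subset Z$ be totally geodesic. (a) Let $F$ be the subequation on $Z$ canonically determined by an $\mathrm O_N$-invariant universal subequation $\mathbf F\subset\mathbf J^2_N$. Then $u|_X$ is $\overline H$-subharmonic on $X$ for each $F$-subharmonic function $u$ on $Z$. If $i^*\mathbf F$ is closed in $\mathbf J^2_n$, then restriction to $X$ holds for $F$. (b) Let $G\subset \mathrm O_N$ be a subgroup, let $Z$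 have a topological $G$-structure for which $X$ is a $G$-submanifold, and let $F$ be the subequation on $Z$ canonically determined by a $G$-invariant universal subequation $\mathbf F\subset\mathbf J^2_N$. Then $u|_X$ is $\overline H$-subharmonic on $X$ for each $F$-subharmonic function $u$ on $Z$. If $i^*\mathbf F$ is closed in $\mathbf J^2_n$, then restriction to $X$ holds for $F$. -/

import Mathlib

open scoped Manifold ContDiff Topology Matrix

noncomputable section

namespace Restriction

/-! ### The universal 2-jet space `J²_N = ℝ × ℝ^N × Sym²(ℝ^N)` -/

/-- The space `Sym²(ℝ^N)` of symmetric matrices. -/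
abbrev SymMat (N : ℕ) : Type := {A : Matrix (Fin N) (Fin N) ℝ // A.IsSymm}

/-- The 2-jet space `J²_N = ℝ × ℝ^N × Sym²(ℝ^N)`, with its usual topology. -/
abbrev Jet (N : ℕ) : Type := ℝ × (Fin N → ℝ) × SymMat N

/-- The natural action `h · (r, p, A) = (r, h p, h A hᵗ)` of matrices on 2-jets. -/
def Jet.act {N : ℕ} (h : Matrix (Fin N) (Fin N) ℝ) (J : Jet N) : Jet N :=
  (J.1, h *ᵥ J.2.1, ⟨h * J.2.2.1 * hᵀ, by
    have hA : J.2.2.1ᵀ = J.2.2.1 := J.2.2.2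
    simp [Matrix.IsSymm, Matrix.transpose_mul, hA, Matrix.mul_assoc]⟩)

/-- Restriction of 2-jets from `ℝ^N` to the span of the first `n` coordinates:
`(r, (p, q), [A, C; Cᵗ, B]) ↦ (r, p, A)`. -/
def Jet.restrict {n N : ℕ} (hn : n ≤ N) (J : Jet N) : Jet n :=
  (J.1, fun i => J.2.1 (Fin.castLE hn i),
    ⟨J.2.2.1.submatrix (Fin.castLE hn) (Fin.castLE hn), J.2.2.2.submatrix _⟩)

/-- `F ⊆ J²_N` is a `G`-invariant universal subequation, where `G ⊆ O_N` is a subgroup. -/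
structure IsUniversalSubequation {N : ℕ}
    (G : Subgroup (Matrix.orthogonalGroup (Fin N) ℝ)) (F : Set (Jet N)) : Prop where
  isClosed : IsClosed F
  /-- `F + (ℝ₋ × {0} × 𝒫) ⊆ F` -/
  add_mem : ∀ (J : Jet N) (s : ℝ) (P : SymMat N), J ∈ F → s ≤ 0 → P.1.PosSemidef →
    ((J.1 + s, J.2.1, ⟨J.2.2.1 + P.1, J.2.2.2.add P.2⟩) : Jet N) ∈ F
  /-- `F` is the closure of its interior in `J²_N`. -/
  closure_interior : F = closure (interior F)
  act_mem : ∀ a ∈ G, ∀ J ∈ F, Jet.act (a : Matrix (Fin N) (Fin N) ℝ) J ∈ F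

/-! ### 2-jets on manifolds, viscosity subsolutions, restriction -/

/-- The model space `ℝ^N`. -/
abbrev Euc (N : ℕ) : Type := EuclideanSpace ℝ (Fin N)

section Jets

variable {N : ℕ} {Z : Type*} [TopologicalSpace Z] [ChartedSpace (Euc N) Z]

/-- A real function on the manifold `Z` is of class `C²` near `z`. -/
abbrev C2At (φ : Z → ℝ) (z : Z) : Prop := ContMDiffAt (𝓡 N) 𝓘(ℝ, ℝ) 2 φ z

/-- The expression of `φ` in the preferred chart at `z`. -/
def inChart (φ : Z → ℝ) (z : Z) : Euc N → ℝ := φ ∘ (chartAt (Euc N) z).symm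

theorem contDiffAt_inChart {φ : Z → ℝ} {z : Z} (hφ : C2At (N := N) φ z) :
    ContDiffAt ℝ 2 (inChart (N := N) φ z) (chartAt (Euc N) z z) := by
  have h := (contMDiffAt_iff.1 hφ).2
  simpa [inChart, extChartAt, OpenPartialHomeomorph.extend, contDiffWithinAt_univ,
    Function.comp_def, chartAt_self_eq] using h

/-- The 2-jet `J_z φ` of a function `φ` which is `C²` near `z`: the triple `(φ, Dφ, D²φ)` of value,
gradient and Hessian matrix in the preferred chart of the manifold at `z`.  This identifies the
fibre `J²_z(Z)` of the 2-jet bundle with `J²_N`, linearly and homeomorphically. -/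
def jet (φ : Z → ℝ) (z : Z) (hφ : C2At (N := N) φ z) : Jet N :=
  (φ z,
   fun i => fderiv ℝ (inChart (N := N) φ z) (chartAt (Euc N) z z) (EuclideanSpace.single i 1),
   ⟨Matrix.of fun i j =>
      fderiv ℝ (fderiv ℝ (inChart (N := N) φ z)) (chartAt (Euc N) z z)
        (EuclideanSpace.single i 1) (EuclideanSpace.single j 1), by
      have h := (contDiffAt_inChart hφ).isSymmSndFDerivAt (by simp)
      ext i j
      exact h _ _⟩)

/-- `u : Z → [-∞, ∞)` is an `F`-subharmonic (upper semi-continuous) function, in the viscosity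
sense, where `F ⊆ J²(Z)` is given by its fibres `F z ⊆ J²_z(Z)`. -/
structure IsSubharmonic (F : Z → Set (Jet N)) (u : Z → EReal) : Prop where
  usc : UpperSemicontinuous u
  ne_top : ∀ z, u z ≠ ⊤
  jet_mem : ∀ (z : Z) (φ : Z → ℝ) (hφ : C2At (N := N) φ z),
    (∀ᶠ y in 𝓝 z, u y ≤ (φ y : EReal)) → u z = (φ z : EReal) → jet φ z hφ ∈ F z

variable {n : ℕ} {X : Type*} [TopologicalSpace X] [ChartedSpace (Euc n) X]

/-- The restriction `i^*F ⊆ J²(X)` of `F ⊆ J²(Z)`, for a map `i : X → Z`: the fibre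
at `x` is the image of `F (i x)` under the restriction `J_{i x} φ ↦ J_x (φ ∘ i)` of 2-jets. -/
def pullback (i : X → Z) (F : Z → Set (Jet N)) (x : X) : Set (Jet n) :=
  {J | ∃ (φ : Z → ℝ) (hφ : C2At (N := N) φ (i x)) (hψ : C2At (N := n) (φ ∘ i) x),
    jet φ (i x) hφ ∈ F (i x) ∧ jet (φ ∘ i) x hψ = J}

/-- Restriction to `X` holds for `F`: if `u` is `F`-subharmonic on `Z`, then `u|_X` is
`i^*F`-subharmonic on `X`. -/
def RestrictionHolds (i : X → Z) (F : Z → Set (Jet N)) : Prop :=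
  ∀ u : Z → EReal, IsSubharmonic F u → IsSubharmonic (pullback (n := n) i F) (u ∘ i)

/-- Restriction to `X` holds for `F` up to fibrewise closure: if `u` is `F`-subharmonic on `Z`,
then `u|_X` is subharmonic on `X` for the fibrewise closure of `i^*F`. -/
def ClosureRestrictionHolds (i : X → Z) (F : Z → Set (Jet N)) : Prop :=
  ∀ u : Z → EReal, IsSubharmonic F u →
    IsSubharmonic (fun x => closure (pullback (n := n) i F x)) (u ∘ i)

end Jets

/-! ### Riemannian geometry in charts -/

section Riemannian

variable {N : ℕ} {Z : Type*} [TopologicalSpace Z] [ChartedSpace (Euc N) Z]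
  [IsManifold (𝓡 N) ∞ Z]

/-- Smooth Riemannian metrics on an `N`-manifold. -/
abbrev RiemMetric (N : ℕ) (Z : Type*) [TopologicalSpace Z] [ChartedSpace (Euc N) Z]
    [IsManifold (𝓡 N) ∞ Z] : Type _ :=
  Bundle.ContMDiffRiemannianMetric (𝓡 N) ∞ (Euc N) (fun z : Z => TangentSpace (𝓡 N) z)

/-- The coordinate vector field `∂_i` of a chart `c`, at the point with coordinates `y`. -/
def coordVec (c : OpenPartialHomeomorph Z (Euc N)) (y : Euc N) (i : Fin N) :
    TangentSpace (𝓡 N) (c.symm y) :=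
  mfderiv 𝓘(ℝ, Euc N) (𝓡 N) c.symm y (EuclideanSpace.single i (1 : ℝ) : Euc N)

/-- The coefficients `g_ij = g(∂_i, ∂_j)` of the metric in a chart. -/
def metricCoeff (g : RiemMetric N Z) (c : OpenPartialHomeomorph Z (Euc N)) (y : Euc N) :
    Matrix (Fin N) (Fin N) ℝ :=
  Matrix.of fun i j => g.inner (c.symm y) (coordVec c y i) (coordVec c y j)

/-- `∂_l g_ij` in a chart. -/
def metricDeriv (g : RiemMetric N Z) (c : OpenPartialHomeomorph Z (Euc N)) (y : Euc N)
    (l i j : Fin N) : ℝ :=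
  fderiv ℝ (fun y' => metricCoeff g c y' i j) y (EuclideanSpace.single l 1)

/-- The Christoffel symbols of the Levi-Civita connection in a chart,
`Γ^k_ij = ½ ∑_l g^{kl} (∂_i g_jl + ∂_j g_il - ∂_l g_ij)`,
so that `∇_{∂_i} ∂_j = ∑_k Γ^k_ij ∂_k`. -/
def christoffel (g : RiemMetric N Z) (c : OpenPartialHomeomorph Z (Euc N)) (y : Euc N)
    (k i j : Fin N) : ℝ :=
  (1 / 2) * ∑ l, (metricCoeff g c y)⁻¹ k l *
    (metricDeriv g c y i j l + metricDeriv g c y j i l - metricDeriv g c y l i j)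

theorem metricDeriv_symm (g : RiemMetric N Z) (c : OpenPartialHomeomorph Z (Euc N)) (y : Euc N)
    (l i j : Fin N) : metricDeriv g c y l i j = metricDeriv g c y l j i := by
  have h : (fun y' => metricCoeff g c y' i j) = fun y' => metricCoeff g c y' j i := by
    funext y'
    exact g.symm _ _ _
  simp only [metricDeriv, h]

theorem christoffel_symm (g : RiemMetric N Z) (c : OpenPartialHomeomorph Z (Euc N)) (y : Euc N)
    (k i j : Fin N) : christoffel g c y k i j = christoffel g c y k j i := by
  simp only [christoffel]
  congr 1
  refine Finset.sum_congr rfl fun l _ => ?_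
  rw [metricDeriv_symm g c y l i j]
  ring

/-- The canonical splitting of the 2-jet bundle given by the Riemannian Hessian: it takes the jet
`(u, Du, D²u)` in the preferred chart at `z` to `(u, du, Hess u)` in the basis `∂_1, …, ∂_N` of
`T_z Z`, where
`(Hess u)(∂_i, ∂_j) = ∂_i ∂_j u - (∇_{∂_i} ∂_j) u = ∂_i ∂_j u - ∑_k Γ^k_ij ∂_k u`. -/
def riemannianJet (g : RiemMetric N Z) (z : Z) (J : Jet N) : Jet N :=
  (J.1, J.2.1, ⟨J.2.2.1 - Matrix.of fun i j =>
      ∑ k, christoffel g (chartAt (Euc N) z) (chartAt (Euc N) z z) k i j * J.2.1 k, by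
    refine J.2.2.2.sub ?_
    ext i j
    simp only [Matrix.transpose_apply, Matrix.of_apply]
    exact Finset.sum_congr rfl fun k _ => by rw [christoffel_symm]⟩)

/-- A family of `N` tangent vectors at `z` is orthonormal (hence an orthonormal basis of `T_z Z`). -/
def IsOrthonormalFrame (g : RiemMetric N Z) (z : Z) (e : Fin N → TangentSpace (𝓡 N) z) : Prop :=
  ∀ i j, g.inner z (e i) (e j) = if i = j then 1 else 0

/-- The matrix `h` with `e_i = ∑_k h_ik ∂_k` in the preferred chart at `z` (tangent vectors at `z`
are elements of the model space through that chart). -/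
def frameMatrix (z : Z) (e : Fin N → TangentSpace (𝓡 N) z) : Matrix (Fin N) (Fin N) ℝ :=
  Matrix.of fun i k => (show Euc N from e i) k

/-- The coordinate representation `[u, du, Hess u] = (u, (e_i u)_i, (Hess u (e_i, e_j))_ij)` of
a 2-jet at `z` in the frame `e` of `T_z Z`. -/
def jetInFrame (g : RiemMetric N Z) (z : Z) (e : Fin N → TangentSpace (𝓡 N) z) (J : Jet N) : Jet N :=
  Jet.act (frameMatrix z e) (riemannianJet g z J)

/-- The subequation on the Riemannian manifold `Z` canonically determined by a universal
`O_N`-invariant subequation `F`: the coordinate representation of the jet in any orthonormal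
basis of `T_z Z` lies in `F`. -/
def riemannianSubequation (g : RiemMetric N Z) (F : Set (Jet N)) (z : Z) : Set (Jet N) :=
  {J | ∀ e : Fin N → TangentSpace (𝓡 N) z, IsOrthonormalFrame g z e → jetInFrame g z e J ∈ F}

/-- A smooth orthonormal frame field on the open set `U` (the values outside `U` are
irrelevant). -/
structure IsSmoothFrameField (g : RiemMetric N Z) (U : TopologicalSpace.Opens Z)
    (e : (z : Z) → Fin N → TangentSpace (𝓡 N) z) : Prop where
  smooth : ∀ i, ContMDiffOn (𝓡 N) ((𝓡 N).prod 𝓘(ℝ, Euc N)) ∞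
    (fun z => (Bundle.TotalSpace.mk z (e z i) : TangentBundle (𝓡 N) Z)) U
  orthonormal : ∀ z ∈ U, IsOrthonormalFrame g z (e z)

/-- The two frame fields differ, at each point of `U ∩ V`, by an element of `G ⊆ O_N`. -/
def ChangeOfFrameIn (G : Subgroup (Matrix.orthogonalGroup (Fin N) ℝ))
    (U : TopologicalSpace.Opens Z) (e : (z : Z) → Fin N → TangentSpace (𝓡 N) z)
    (V : TopologicalSpace.Opens Z) (e' : (z : Z) → Fin N → TangentSpace (𝓡 N) z) : Prop :=
  ∀ z ∈ U, z ∈ V → ∃ a ∈ G, ∀ i, e' z i = ∑ j, (a : Matrix (Fin N) (Fin N) ℝ) i j • e z j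

/-- A topological `G`-structure on a Riemannian manifold: a maximal family of (admissible) smooth
orthonormal frame fields on open sets covering `Z`, whose changes of framings take values
in `G ⊆ O_N`. -/
structure TopologicalGStructure (g : RiemMetric N Z)
    (G : Subgroup (Matrix.orthogonalGroup (Fin N) ℝ)) where
  Admissible : TopologicalSpace.Opens Z → ((z : Z) → Fin N → TangentSpace (𝓡 N) z) → Prop
  frameField : ∀ U e, Admissible U e → IsSmoothFrameField g U e
  cover : ∀ z : Z, ∃ U e, Admissible U e ∧ z ∈ U
  change : ∀ U e V e', Admissible U e → Admissible V e' → ChangeOfFrameIn G U e V e'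
  maximal : ∀ V e', IsSmoothFrameField g V e' →
    (∀ U e, Admissible U e → ChangeOfFrameIn G U e V e') → Admissible V e'

/-- The subequation on a manifold with topological `G`-structure canonically determined by a
universal `G`-invariant subequation `F`: the coordinate representation of the jet in
any admissible frame lies in `F`. -/
def gSubequation {g : RiemMetric N Z} {G : Subgroup (Matrix.orthogonalGroup (Fin N) ℝ)}
    (S : TopologicalGStructure g G) (F : Set (Jet N)) (z : Z) : Set (Jet N) :=
  {J | ∀ U e, S.Admissible U e → z ∈ U → jetInFrame g z (e z) J ∈ F}

variable {n : ℕ} {X : Type*} [TopologicalSpace X] [ChartedSpace (Euc n) X]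

/-- The expression of `i : X → Z` in the preferred charts at `x` and `i x`. -/
def mapInCharts (i : X → Z) (x : X) : Euc n → Euc N :=
  chartAt (Euc N) (i x) ∘ i ∘ (chartAt (Euc n) x).symm

/-- The submanifold `i : X → Z` is totally geodesic: for the coordinate vector fields `∂'_a` of a
chart of `X`, the ambient covariant derivative `∇_{∂'_a} (i_* ∂'_b)` is tangent to `X`.  With `f` the
expression of `i` in charts, it is the vector `D²f(∂'_a, ∂'_b) + Γ(Df ∂'_a, Df ∂'_b)`. -/
def IsTotallyGeodesic (g : RiemMetric N Z) (i : X → Z) : Prop :=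
  ∀ (x : X) (a b : Fin n),
    let f : Euc n → Euc N := mapInCharts i x
    let x₀ : Euc n := chartAt (Euc n) x x
    let v : Euc n := EuclideanSpace.single a 1
    let w : Euc n := EuclideanSpace.single b 1
    ∃ t : Euc n, fderiv ℝ f x₀ t = fderiv ℝ (fderiv ℝ f) x₀ v w + WithLp.toLp 2 fun k =>
      ∑ p, ∑ q, christoffel g (chartAt (Euc N) (i x)) (chartAt (Euc N) (i x) (i x)) k p q *
        (fderiv ℝ f x₀ v) p * (fderiv ℝ f x₀ w) q

/-- `i : X → Z` is a `G`-submanifold: near each of its points there is an admissible framing `e`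
such that `e_1, …, e_n` are tangent to `X` and `e_{n+1}, …, e_N` are normal to `X` along `X`. -/
def IsGSubmanifold {g : RiemMetric N Z} {G : Subgroup (Matrix.orthogonalGroup (Fin N) ℝ)}
    (S : TopologicalGStructure g G) (i : X → Z) : Prop :=
  ∀ x : X, ∃ U e, S.Admissible U e ∧ i x ∈ U ∧ ∀ y : X, i y ∈ U → ∀ k : Fin N,
    ((k : ℕ) < n → ∃ t : TangentSpace (𝓡 n) y, mfderiv (𝓡 n) (𝓡 N) i y t = e (i y) k) ∧
    (n ≤ (k : ℕ) → ∀ t : TangentSpace (𝓡 n) y,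
      g.inner (i y) (e (i y) k) (mfderiv (𝓡 n) (𝓡 N) i y t) = 0)

end Riemannian

end Restriction

end

open Restriction

namespace Restriction

open Filter

/-! ### Calculus -/

section Calculus

variable {E F G : Type*} [NormedAddCommGroup E] [NormedSpace ℝ E] [NormedAddCommGroup F]
  [NormedSpace ℝ F] [NormedAddCommGroup G] [NormedSpace ℝ G]

/-! Let φ touch u ∘ i from above at x. Use charts in which i is a linear inclusion ι with linear
retraction π, so that Q = id - ιπ measures the deviation from X. Extend φ to be constant on the
fibres of π, and add a term vanishing to third order at the base point to make the contact strict
along X. Maxima y_j over a small ball of u minus this function minus k_j‖Q‖² converge to i x, with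
k_j‖Q y_j‖² → 0 (`exists_penalized_maxima`). The penalised functions, shifted by constants, are test
functions for u on Z at these points, so their jets satisfy the subequation there.

Read such a jet in an orthonormal frame E and keep only its first n directions. The penalty then
enters, up to a factor 2, through k⟨Qy, QE_a⟩, k⟨QE_a, QE_b⟩ and k⟨Qy, QΓ(E_a, E_b)⟩. All three are
O(k‖Qy‖²), hence negligible, as soon as QE_a and QΓ(E_a, E_b) are O(‖Qy‖). The first bound says that
the frame is tangent to X up to first order. The second holds because Γ maps pairs of vectors
tangent to X to tangent vectors along X, which is what totally geodesic means in these charts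
(`Q_christoffelForm_base`, `exists_bound_bilinear_normal_component`). The remaining components may
diverge, but restriction discards them; this is why the limit is only known to lie in the closure of
the restricted set (`exists_tangential_limit`).

To return to X, total geodesy is used once more: the tangential part of the Hessian depends only on
the function restricted to X, so convergence of tangential frame components gives convergence of
jets on X (`tendsto_jet_comp`). Since every element of J²_N is the jet of a function in a given
frame (`exists_jetInFrame_eq`), the limit lies in the closure of the pulled back fibre, and in the
fibre itself when the restricted universal set is closed (`jet_mem_pullback`).

Parts (a) and (b) differ only in the frames supplied (`IsAdaptedFrame`): pointwise Gram-Schmidt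
frames together with O_N-invariance in (a), an admissible framing together with G-invariance in (b).
-/

theorem eventually_differentiableAt_of_contDiffAt {f : E → F} {x : E}
    (hf : ContDiffAt ℝ 2 f x) : ∀ᶠ y in 𝓝 x, DifferentiableAt ℝ f y := by
  filter_upwards [hf.eventually (by simp)] with y hy
  exact hy.differentiableAt (by simp)

theorem differentiableAt_fderiv_of_contDiffAt {f : E → F} {x : E}
    (hf : ContDiffAt ℝ 2 f x) : DifferentiableAt ℝ (fderiv ℝ f) x :=
  (hf.fderiv_right (m := 1) (by norm_num)).differentiableAt (by simp)

/-- The second-order chain rule. -/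
theorem fderiv_fderiv_comp {f : F → G} {h : E → F} {x : E} (hf : ContDiffAt ℝ 2 f (h x))
    (hh : ContDiffAt ℝ 2 h x) (v w : E) :
    fderiv ℝ (fderiv ℝ (f ∘ h)) x v w =
      fderiv ℝ (fderiv ℝ f) (h x) (fderiv ℝ h x v) (fderiv ℝ h x w) +
        fderiv ℝ f (h x) (fderiv ℝ (fderiv ℝ h) x v w) := by
  have h1 : fderiv ℝ (f ∘ h) =ᶠ[𝓝 x] fun y => (fderiv ℝ f (h y)).comp (fderiv ℝ h y) := by
    filter_upwards [hh.continuousAt.eventually (eventually_differentiableAt_of_contDiffAt hf),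
      eventually_differentiableAt_of_contDiffAt hh] with y hy hy'
    exact fderiv_comp y hy hy'
  have h2 : HasFDerivAt (fun y => fderiv ℝ f (h y))
      ((fderiv ℝ (fderiv ℝ f) (h x)).comp (fderiv ℝ h x)) x :=
    (differentiableAt_fderiv_of_contDiffAt hf).hasFDerivAt.comp x
      (hh.differentiableAt (by simp)).hasFDerivAt
  rw [h1.fderiv_eq, (h2.clm_comp (differentiableAt_fderiv_of_contDiffAt hh).hasFDerivAt).fderiv]
  simp [add_comm]

theorem fderiv_comp_clm {f : F → G} (L : E →L[ℝ] F) {x : E} (hf : DifferentiableAt ℝ f (L x))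
    (v : E) : fderiv ℝ (f ∘ L) x v = fderiv ℝ f (L x) (L v) := by
  rw [fderiv_comp x hf L.differentiableAt]
  simp

theorem fderiv_fderiv_comp_clm {f : F → G} (L : E →L[ℝ] F) {x : E}
    (hf : ContDiffAt ℝ 2 f (L x)) (v w : E) :
    fderiv ℝ (fderiv ℝ (f ∘ L)) x v w = fderiv ℝ (fderiv ℝ f) (L x) (L v) (L w) := by
  have h0 : fderiv ℝ (fderiv ℝ (L : E → F)) x = 0 := by
    have : fderiv ℝ (L : E → F) = fun _ => L := by ext1 y; simp
    rw [this]; simp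
  rw [fderiv_fderiv_comp hf L.contDiff.contDiffAt, h0]
  simp

theorem fderiv_fderiv_clm_comp {f : E → F} (L : F →L[ℝ] G) {x : E}
    (hf : ContDiffAt ℝ 2 f x) (v w : E) :
    fderiv ℝ (fderiv ℝ (L ∘ f)) x v w = L (fderiv ℝ (fderiv ℝ f) x v w) := by
  have h0 : fderiv ℝ (fderiv ℝ (L : F → G)) (f x) = 0 := by
    have : fderiv ℝ (L : F → G) = fun _ => L := by ext1 y; simp
    rw [this]; simp
  rw [fderiv_fderiv_comp L.contDiff.contDiffAt hf, h0]
  simp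

theorem fderiv_fderiv_add {f h : E → F} {x : E} (hf : ContDiffAt ℝ 2 f x)
    (hh : ContDiffAt ℝ 2 h x) :
    fderiv ℝ (fderiv ℝ (f + h)) x = fderiv ℝ (fderiv ℝ f) x + fderiv ℝ (fderiv ℝ h) x := by
  have h1 : fderiv ℝ (f + h) =ᶠ[𝓝 x] fderiv ℝ f + fderiv ℝ h := by
    filter_upwards [eventually_differentiableAt_of_contDiffAt hf,
      eventually_differentiableAt_of_contDiffAt hh] with y hy hy'
    exact fderiv_add hy hy'
  rw [h1.fderiv_eq, fderiv_add (differentiableAt_fderiv_of_contDiffAt hf)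
    (differentiableAt_fderiv_of_contDiffAt hh)]

theorem fderiv_fderiv_const_smul {f : E → F} {x : E} (hf : ContDiffAt ℝ 2 f x) (k : ℝ) :
    fderiv ℝ (fderiv ℝ (k • f)) x = k • fderiv ℝ (fderiv ℝ f) x := by
  have h1 : fderiv ℝ (k • f) =ᶠ[𝓝 x] k • fderiv ℝ f := by
    filter_upwards [eventually_differentiableAt_of_contDiffAt hf] with y hy
    exact fderiv_const_smul hy k
  rw [h1.fderiv_eq, fderiv_const_smul (differentiableAt_fderiv_of_contDiffAt hf)]

theorem fderiv_fderiv_add_const (f : E → F) (x : E) (c : F) :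
    fderiv ℝ (fderiv ℝ fun y => f y + c) x = fderiv ℝ (fderiv ℝ f) x := by
  have : (fderiv ℝ fun y => f y + c) = fderiv ℝ f := by
    ext1 y; exact fderiv_add_const c
  rw [this]

/-- A function with prescribed 2-jet. -/
theorem exists_contDiff_jet_eq (r : ℝ) (p : E →L[ℝ] ℝ) (A : E →L[ℝ] E →L[ℝ] ℝ)
    (hA : ∀ v w, A v w = A w v) (a : E) :
    ∃ f : E → ℝ, ContDiff ℝ 2 f ∧ f a = r ∧ fderiv ℝ f a = p ∧ fderiv ℝ (fderiv ℝ f) a = A := by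
  have hd : ∀ y, HasFDerivAt (fun y => r + p (y - a) + (1 / 2) * A (y - a) (y - a))
      (p + A (y - a)) y := by
    intro y
    have h1 : HasFDerivAt (fun y : E => y - a) (ContinuousLinearMap.id ℝ E) y :=
      (hasFDerivAt_id y).sub_const a
    have h2 := (p.hasFDerivAt (x := y - a)).comp y h1
    have h3 := ((A.hasFDerivAt (x := y - a)).comp y h1).clm_apply h1
    have h4 := (h2.const_add r).add (h3.const_mul (1 / 2))
    refine h4.congr_fderiv ?_
    ext v
    simp [hA v]
    ring
  refine ⟨fun y => r + p (y - a) + (1 / 2) * A (y - a) (y - a), by fun_prop, by simp, ?_, ?_⟩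
  · rw [(hd a).fderiv]; simp
  · have : fderiv ℝ (fun y => r + p (y - a) + (1 / 2) * A (y - a) (y - a)) =
        fun y => p + A (y - a) := funext fun y => (hd y).fderiv
    rw [this]
    simp only [map_sub]
    exact ((A.hasFDerivAt.sub_const (A a)).const_add p).fderiv

end Calculus

/-! ### The Koszul formula and coordinate changes, for metrics on a vector space -/

section Koszul

variable {E : Type*} [NormedAddCommGroup E] [NormedSpace ℝ E]

/-- Stated for an arbitrary linearly closed predicate, so that it serves identities as well as
convergence statements and membership in a range; multilinear claims are reduced to a basis one slot
at a time. -/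
theorem basis_induction {ι : Type*} (b : Module.Basis ι ℝ E) {P : E → Prop}
    (hadd : ∀ v w, P v → P w → P (v + w)) (hsmul : ∀ (r : ℝ) v, P v → P (r • v)) (h0 : P 0)
    (hb : ∀ i, P (b i)) (v : E) : P v := by
  refine Submodule.span_induction (p := fun v _ => P v) ?_ h0 (fun v w _ _ => hadd v w)
    (fun r v _ => hsmul r v) (b.mem_span v)
  rintro _ ⟨i, rfl⟩
  exact hb i

/-- The Koszul formula at a point holds if it holds on a basis. -/
theorem koszul_of_basis {ι : Type*} (b : Module.Basis ι ℝ E) {B : E →L[ℝ] E →L[ℝ] ℝ}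
    {D : E →L[ℝ] E →L[ℝ] E →L[ℝ] ℝ} {Γ : E →L[ℝ] E →L[ℝ] E}
    (h : ∀ i j l, B (Γ (b i) (b j)) (b l) =
      (1 / 2) * (D (b i) (b j) (b l) + D (b j) (b i) (b l) - D (b l) (b i) (b j)))
    (v w t : E) : B (Γ v w) t = (1 / 2) * (D v w t + D w v t - D t v w) := by
  induction v using basis_induction b with
  | hadd v v' h h' => simp only [map_add, add_apply, h, h']; ring
  | hsmul r v h => simp only [map_smul, smul_apply, h, smul_eq_mul]; ring
  | h0 => simp
  | hb i =>
  induction w using basis_induction b with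
  | hadd v v' h h' => simp only [map_add, add_apply, h, h']; ring
  | hsmul r v h => simp only [map_smul, smul_apply, h, smul_eq_mul]; ring
  | h0 => simp
  | hb j =>
  induction t using basis_induction b with
  | hadd v v' h h' => simp only [map_add, add_apply, h, h']; ring
  | hsmul r v h => simp only [map_smul, smul_apply, h, smul_eq_mul]; ring
  | h0 => simp
  | hb l => exact h i j l

/-- The transformation law of Christoffel symbols under a change of coordinates `ψ`. -/
theorem christoffel_transition_of_koszul {B B' : E → E →L[ℝ] E →L[ℝ] ℝ} {ψ : E → E} {y : E}
    {Γ Γ' : E →L[ℝ] E →L[ℝ] E} (hψ : ContDiffAt ℝ 2 ψ y) (hB : DifferentiableAt ℝ B y)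
    (hB' : DifferentiableAt ℝ B' (ψ y))
    (hBB' : ∀ᶠ x in 𝓝 y, ∀ v w, B x v w = B' (ψ x) (fderiv ℝ ψ x v) (fderiv ℝ ψ x w))
    (hsymm : ∀ v w, B' (ψ y) v w = B' (ψ y) w v) (hpos : ∀ v, v ≠ 0 → 0 < B' (ψ y) v v)
    (hsurj : Function.Surjective (fderiv ℝ ψ y))
    (hΓ : ∀ v w t, B y (Γ v w) t =
      (1 / 2) * (fderiv ℝ B y v w t + fderiv ℝ B y w v t - fderiv ℝ B y t v w))
    (hΓ' : ∀ v w t, B' (ψ y) (Γ' v w) t =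
      (1 / 2) * (fderiv ℝ B' (ψ y) v w t + fderiv ℝ B' (ψ y) w v t - fderiv ℝ B' (ψ y) t v w))
    (v w : E) :
    fderiv ℝ ψ y (Γ v w) =
      Γ' (fderiv ℝ ψ y v) (fderiv ℝ ψ y w) + fderiv ℝ (fderiv ℝ ψ) y v w := by
  have hdψ := hψ.differentiableAt (by simp)
  have hd2 := differentiableAt_fderiv_of_contDiffAt hψ
  -- Differentiate the relation saying that B is the pullback of B' by ψ; the product rule produces
  -- two terms with D²ψ.
  have hder : ∀ u v w : E, fderiv ℝ B y u v w =
      fderiv ℝ B' (ψ y) (fderiv ℝ ψ y u) (fderiv ℝ ψ y v) (fderiv ℝ ψ y w) +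
      B' (ψ y) (fderiv ℝ (fderiv ℝ ψ) y u v) (fderiv ℝ ψ y w) +
      B' (ψ y) (fderiv ℝ ψ y v) (fderiv ℝ (fderiv ℝ ψ) y u w) := by
    intro u v w
    have e1 := (hB.hasFDerivAt.clm_apply (hasFDerivAt_const v y)).clm_apply (hasFDerivAt_const w y)
    have e0 : HasFDerivAt (fun x => B' (ψ x)) ((fderiv ℝ B' (ψ y)).comp (fderiv ℝ ψ y)) y :=
      HasFDerivAt.comp (g := B') y hB'.hasFDerivAt hdψ.hasFDerivAt
    have e2 := (e0.clm_apply
      (hd2.hasFDerivAt.clm_apply (hasFDerivAt_const v y))).clm_apply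
      (hd2.hasFDerivAt.clm_apply (hasFDerivAt_const w y))
    have heq : (fun y => B y v w) =ᶠ[𝓝 y] fun y =>
        B' (ψ y) (fderiv ℝ ψ y v) (fderiv ℝ ψ y w) := by
      filter_upwards [hBB'] with x hx
      exact hx v w
    have e3 := congrArg (fun L : E →L[ℝ] ℝ => L u) (e1.unique (e2.congr_of_eventuallyEq heq))
    simp at e3
    rw [e3]
    ring
  have hs2 : ∀ a b, fderiv ℝ (fderiv ℝ ψ) y a b = fderiv ℝ (fderiv ℝ ψ) y b a :=
    fun a b => (hψ.isSymmSndFDerivAt (by simp)) a b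
  -- In the Koszul combination the D²ψ terms cancel by symmetry, except for B'(D²ψ(v, w), Dψ t).
  have hform : ∀ t, B' (ψ y) (fderiv ℝ ψ y (Γ v w))
      (fderiv ℝ ψ y t) = B' (ψ y) (Γ' (fderiv ℝ ψ y v)
        (fderiv ℝ ψ y w) + fderiv ℝ (fderiv ℝ ψ) y v w) (fderiv ℝ ψ y t) := by
    intro t
    rw [← hBB'.self_of_nhds, hΓ, map_add, add_apply, hΓ', hder, hder, hder,
      hs2 w v, hs2 t v, hs2 t w, hsymm (fderiv ℝ ψ y w) (fderiv ℝ (fderiv ℝ ψ) y v t)]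
    ring
  rw [← sub_eq_zero]
  by_contra hne
  -- Test against t whose image is the difference of the two sides: its square length is zero,
  -- contradicting definiteness.
  obtain ⟨t, ht⟩ := hsurj (fderiv ℝ ψ y (Γ v w) -
      (Γ' (fderiv ℝ ψ y v) (fderiv ℝ ψ y w) + fderiv ℝ (fderiv ℝ ψ) y v w))
  have h0 := hform t
  rw [ht, ← sub_eq_zero, ← sub_apply, ← map_sub] at h0
  exact (hpos _ hne).ne' h0

end Koszul

/-! ### Derivatives of squared norms of linear maps -/

section NormSq

variable {E F : Type*} [NormedAddCommGroup E] [NormedSpace ℝ E] [NormedAddCommGroup F]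
  [InnerProductSpace ℝ F] (Q : E →L[ℝ] F)

theorem fderiv_normSq_clm (y v : E) :
    fderiv ℝ (fun y => ‖Q y‖ ^ 2) y v = 2 * inner ℝ (Q y) (Q v) := by
  rw [((Q.hasFDerivAt (x := y)).norm_sq).fderiv]
  simp

theorem fderiv_fderiv_normSq_clm (y v w : E) :
    fderiv ℝ (fderiv ℝ (fun y => ‖Q y‖ ^ 2)) y v w = 2 * inner ℝ (Q v) (Q w) := by
  have h : fderiv ℝ (fun y => ‖Q y‖ ^ 2) =
      ((2 : ℝ) • (innerSL ℝ (E := F)).bilinearComp Q Q : E →L[ℝ] E →L[ℝ] ℝ) := by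
    ext y v
    rw [fderiv_normSq_clm]; simp
  rw [h, ContinuousLinearMap.fderiv]
  simp

/-- The fourth power of the distance vanishes to third order. -/
theorem jet_normSq_sq (a : E) (b : F) (hab : Q a = b) :
    ContDiff ℝ 2 (fun y => (‖Q y - b‖ ^ 2) ^ 2) ∧
    fderiv ℝ (fun y => (‖Q y - b‖ ^ 2) ^ 2) a = 0 ∧
    fderiv ℝ (fderiv ℝ (fun y => (‖Q y - b‖ ^ 2) ^ 2)) a = 0 := by
  have hs : ContDiff ℝ 2 (fun t : ℝ => t ^ 2) := by fun_prop
  have hq : ContDiff ℝ 2 (fun y => ‖Q y - b‖ ^ 2) := by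
    have : ContDiff ℝ 2 (fun y => Q y - b) := by fun_prop
    exact this.norm_sq ℝ
  have h0 : fderiv ℝ (fun y => ‖Q y - b‖ ^ 2) a = 0 := by
    apply IsLocalMin.fderiv_eq_zero
    refine Filter.Eventually.of_forall fun y => ?_
    simp [hab]
  have hs0 : fderiv ℝ (fun t : ℝ => t ^ 2) (‖Q a - b‖ ^ 2) = 0 := by
    ext; simp [hab]
  refine ⟨hs.comp hq, ?_, ?_⟩
  · have := fderiv_comp a (g := fun t : ℝ => t ^ 2) (f := fun y => ‖Q y - b‖ ^ 2)
      (hs.differentiable (by simp) _) (hq.differentiable (by simp) _)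
    rw [h0] at this
    simpa [Function.comp_def] using this
  · ext v w
    have := fderiv_fderiv_comp (f := fun t : ℝ => t ^ 2) (h := fun y => ‖Q y - b‖ ^ 2)
      (x := a) hs.contDiffAt hq.contDiffAt v w
    rw [h0, hs0] at this
    simpa [Function.comp_def] using this

end NormSq

/-- Penalisation: touching points for `V` along the zero set of `q` are limits of unconstrained
touching points. -/
theorem exists_penalized_maxima {E : Type*} [NormedAddCommGroup E] [NormedSpace ℝ E]
    [ProperSpace E] {V : E → EReal} {α q : E → ℝ} {a : E} {s : Set E} (hs : s ∈ 𝓝 a)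
    (hV : ∀ y ∈ s, UpperSemicontinuousAt V y) (htop : ∀ y ∈ s, V y ≠ ⊤) (hα : ContinuousOn α s)
    (hq : Continuous q) (hq0 : ∀ y, 0 ≤ q y) (ha : V a = α a) (hqa : q a = 0)
    (hlt : ∀ y ∈ s, q y = 0 → y ≠ a → V y < α y) :
    ∃ (y : ℕ → E) (k c : ℕ → ℝ), Tendsto y atTop (𝓝 a) ∧
      Tendsto (fun j => k j * q (y j)) atTop (𝓝 0) ∧ Tendsto c atTop (𝓝 0) ∧ (∀ j, 0 ≤ k j) ∧
      (∀ j, V (y j) = ((α (y j) + k j * q (y j) + c j : ℝ) : EReal)) ∧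
      ∀ᶠ j in atTop, ∀ᶠ w in 𝓝 (y j), V w ≤ ((α w + k j * q w + c j : ℝ) : EReal) := by
  obtain ⟨r, hr, hrs⟩ := Metric.nhds_basis_closedBall.mem_iff.1 hs
  set K := Metric.closedBall a r
  have hK : IsCompact K := isCompact_closedBall a r
  have haK : a ∈ K := Metric.mem_closedBall_self hr.le
  have hαK : ContinuousOn α K := hα.mono hrs
  have hVK : UpperSemicontinuousOn V K := fun y hy => (hV y (hrs hy)).upperSemicontinuousWithinAt K
  -- Maximise V - α - jq over the compact ball. The maximum is c, and c ≥ 0 because the value at a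
  -- is 0.
  have hexists : ∀ j : ℕ, ∃ y ∈ K, ∃ c : ℝ, 0 ≤ c ∧
      V y = ((α y + j * q y + c : ℝ) : EReal) ∧
      ∀ w ∈ K, V w ≤ ((α w + j * q w + c : ℝ) : EReal) := by
    intro j
    have hcont : ContinuousOn (fun y => -(α y + j * q y)) K := by fun_prop
    have husc : UpperSemicontinuousOn
        (fun y => V y + ((-(α y + j * q y) : ℝ) : EReal)) K := by
      refine UpperSemicontinuousOn.add' hVK ?_ ?_
      · exact (continuous_coe_real_ereal.comp_continuousOn hcont).upperSemicontinuousOn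
      · intro y hy
        exact EReal.continuousAt_add (Or.inr (EReal.coe_ne_bot _)) (Or.inr (EReal.coe_ne_top _))
    obtain ⟨y, hyK, hy⟩ := husc.exists_isMaxOn ⟨a, haK⟩ hK
    have hya := hy haK
    simp only [Set.mem_ofPred_eq, ha, hqa, mul_zero, add_zero] at hya
    rw [← EReal.coe_add, add_neg_cancel] at hya
    have hbot : V y ≠ ⊥ := by
      intro h
      rw [h, EReal.bot_add] at hya
      exact absurd hya (by simp)
    lift V y to ℝ using ⟨htop y (hrs hyK), hbot⟩ with v hv
    rw [← EReal.coe_add] at hya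
    have hya' : (0 : ℝ) ≤ v + -(α y + j * q y) := by exact_mod_cast hya
    refine ⟨y, hyK, v - (α y + j * q y), by linarith, ?_, fun w hw => ?_⟩
    · rw [← hv]; congr 1; ring
    · have hw' := hy hw
      simp only [Set.mem_ofPred_eq, ← hv] at hw'
      rw [← EReal.coe_add] at hw'
      induction hVw : V w with
      | bot => exact bot_le
      | top => exact absurd hVw (htop w (hrs hw))
      | coe t =>
        rw [hVw, ← EReal.coe_add] at hw'
        have : t + -(α w + j * q w) ≤ v + -(α y + j * q y) := by exact_mod_cast hw'
        have h2 : t ≤ α w + j * q w + (v - (α y + j * q y)) := by linarith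
        exact_mod_cast h2
  choose y hyK c hc hVy hmax using hexists
  obtain ⟨yM, hyMK, hyM⟩ := hVK.exists_isMaxOn ⟨a, haK⟩ hK
  obtain ⟨ym, hymK, hym⟩ := hK.exists_isMinOn ⟨a, haK⟩ hαK
  obtain ⟨M, hM⟩ : ∃ M : ℝ, V yM = M := by
    refine ⟨(V yM).toReal, (EReal.coe_toReal (htop _ (hrs hyMK)) ?_).symm⟩
    intro h
    have := hyM haK
    simp only [Set.mem_ofPred_eq, h, ha] at this
    exact absurd this (by simp)
  -- The penalty stays bounded while j grows, so q vanishes at every limit point.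
  have hbd : ∀ j : ℕ, j * q (y j) ≤ M - α ym := by
    intro j
    have h1 := hyM (hyK j)
    have h2 := hym (hyK j)
    simp only [Set.mem_ofPred_eq, hM, hVy j] at h1 h2
    have h1' : α (y j) + j * q (y j) + c j ≤ M := by exact_mod_cast h1
    linarith [hc j]
  obtain ⟨ys, hysK, φ, hφ, hlim⟩ := hK.tendsto_subseq hyK
  have hqs : q ys = 0 := by
    refine le_antisymm ?_ (hq0 _)
    have h1 : Tendsto (fun j => q (y (φ j))) atTop (𝓝 (q ys)) := (hq.tendsto ys).comp hlim
    have h2 : Tendsto (fun j => (M - α ym) / (φ j : ℝ)) atTop (𝓝 0) :=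
      (tendsto_const_nhds.div_atTop tendsto_natCast_atTop_atTop).comp hφ.tendsto_atTop
    refine le_of_tendsto_of_tendsto h1 h2 ?_
    filter_upwards [hφ.tendsto_atTop.eventually (eventually_gt_atTop 0)] with j hj
    rw [le_div_iff₀ (by exact_mod_cast hj), mul_comm]
    exact hbd (φ j)
  have hαlim : Tendsto (fun j => α (y (φ j))) atTop (𝓝 (α ys)) :=
    (hαK ys hysK).tendsto.comp
      (tendsto_nhdsWithin_iff.2 ⟨hlim, Eventually.of_forall fun _ => hyK _⟩)
  -- At any other zero of q, V lies strictly below α; upper semicontinuity keeps this true nearby,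
  -- whereas V ≥ α at the maxima.
  have hys : ys = a := by
    by_contra hne
    obtain ⟨b, hb1, hb2⟩ := EReal.lt_iff_exists_real_btwn.1 (hlt ys (hrs hysK) hqs hne)
    have h1 := hlim.eventually (hV ys (hrs hysK) b hb1)
    have h2 := hαlim.eventually (lt_mem_nhds (EReal.coe_lt_coe_iff.1 hb2))
    obtain ⟨j, hj1, hj2⟩ := (h1.and h2).exists
    simp only [Function.comp, hVy] at hj1
    have hj1' : α (y (φ j)) + φ j * q (y (φ j)) + c (φ j) < b := by exact_mod_cast hj1
    have : 0 ≤ φ j * q (y (φ j)) := mul_nonneg (by positivity) (hq0 _)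
    linarith [hc (φ j)]
  subst hys
  -- The sum equals V - α at the maxima, whose upper limit is at most V a - α a = 0. Both summands
  -- are nonnegative, so each tends to 0.
  have hsum : Tendsto (fun j => φ j * q (y (φ j)) + c (φ j)) atTop (𝓝 0) := by
    rw [Metric.tendsto_atTop']
    have key : ∀ ε > 0, ∀ᶠ j in atTop, φ j * q (y (φ j)) + c (φ j) < ε := by
      intro ε hε
      have hVlt : V ys < ((α ys + ε / 2 : ℝ) : EReal) := by
        rw [ha]; exact_mod_cast (by linarith : α ys < α ys + ε / 2)
      have h1 := hlim.eventually (hV ys (hrs hysK) _ hVlt)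
      have h2 := hαlim.eventually (lt_mem_nhds (by linarith : α ys - ε / 2 < α ys))
      filter_upwards [h1, h2] with j hj1 hj2
      simp only [Function.comp, hVy] at hj1
      have hj1' : α (y (φ j)) + φ j * q (y (φ j)) + c (φ j) < α ys + ε / 2 := by
        exact_mod_cast hj1
      linarith
    intro ε hε
    obtain ⟨n, hn⟩ := eventually_atTop.1 (key ε hε)
    refine ⟨n, fun j hj => ?_⟩
    have : 0 ≤ φ j * q (y (φ j)) := mul_nonneg (by positivity) (hq0 _)
    rw [Real.dist_eq, sub_zero, abs_of_nonneg (by linarith [hc (φ j)])]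
    exact hn j hj.le
  refine ⟨y ∘ φ, fun j => φ j, c ∘ φ, hlim, ?_, ?_, fun j => by positivity,
    fun j => hVy (φ j), ?_⟩
  · refine squeeze_zero (fun j => mul_nonneg (by positivity) (hq0 _)) (fun j => ?_) hsum
    simpa using hc (φ j)
  · refine squeeze_zero (fun j => hc _) (fun j => ?_) hsum
    have : 0 ≤ φ j * q (y (φ j)) := mul_nonneg (by positivity) (hq0 _)
    simpa using this
  -- The maximum over the closed ball is a local one only at interior points, which the maxima
  -- eventually are.
  · filter_upwards [hlim.eventually (Metric.ball_mem_nhds ys hr)] with j hj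
    filter_upwards [Metric.isOpen_ball.mem_nhds hj] with w hw
    exact hmax (φ j) w (Metric.ball_subset_closedBall hw)

/-! ### The metric and the Christoffel symbols in an arbitrary chart -/

section Metric

variable {N : ℕ} {Z : Type*} [TopologicalSpace Z] [ChartedSpace (Euc N) Z]
  [IsManifold (𝓡 N) ∞ Z]

/-- The derivative of the inverse of a chart, as a map into the model space. -/
noncomputable def chartDeriv (c : OpenPartialHomeomorph Z (Euc N)) (y : Euc N) :
    Euc N →L[ℝ] Euc N :=
  mfderiv 𝓘(ℝ, Euc N) (𝓡 N) c.symm y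

/-- The metric as a bilinear form in the coordinates of a chart. -/
noncomputable def metricForm (g : RiemMetric N Z) (c : OpenPartialHomeomorph Z (Euc N))
    (y : Euc N) : Euc N →L[ℝ] Euc N →L[ℝ] ℝ :=
  (show Euc N →L[ℝ] Euc N →L[ℝ] ℝ from g.inner (c.symm y)).bilinearComp
    (chartDeriv c y) (chartDeriv c y)

theorem metricCoeff_eq (g : RiemMetric N Z) (c : OpenPartialHomeomorph Z (Euc N)) (y : Euc N)
    (i j : Fin N) : metricCoeff g c y i j =
      metricForm g c y (EuclideanSpace.single i 1) (EuclideanSpace.single j 1) := rfl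

theorem metricForm_symm (g : RiemMetric N Z) (c : OpenPartialHomeomorph Z (Euc N)) (y v w : Euc N) :
    metricForm g c y v w = metricForm g c y w v :=
  g.symm _ _ _

variable {c : OpenPartialHomeomorph Z (Euc N)}

/-- This field is the constant section v transported by the tangent map of the smooth inverse chart.
-/
theorem contMDiffOn_chartDeriv (hc : c ∈ IsManifold.maximalAtlas (𝓡 N) ∞ Z) (v : Euc N) :
    ContMDiffOn 𝓘(ℝ, Euc N) ((𝓡 N).prod 𝓘(ℝ, Euc N)) ∞
      (fun y => (⟨c.symm y, chartDeriv c y v⟩ : TangentBundle (𝓡 N) Z)) c.target := by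
  have h1 := (contMDiffOn_symm_of_mem_maximalAtlas hc).contMDiffOn_tangentMapWithin
    (m := ∞) (by simp) c.open_target.uniqueMDiffOn
  have h2 : ContMDiff 𝓘(ℝ, Euc N) 𝓘(ℝ, Euc N).tangent ∞
      (fun y : Euc N => (⟨y, v⟩ : TangentBundle 𝓘(ℝ, Euc N) (Euc N))) :=
    contMDiff_vectorSpace_iff_contDiff.2 contDiff_const
  refine (h1.comp h2.contMDiffOn (s := c.target) (fun y hy => hy)).congr fun y hy => ?_
  simp only [Function.comp, tangentMapWithin, mfderivWithin_of_isOpen c.open_target hy]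
  rfl

open Bundle in
theorem contDiffOn_metricForm (g : RiemMetric N Z)
    (hc : c ∈ IsManifold.maximalAtlas (𝓡 N) ∞ Z) :
    ContDiffOn ℝ ∞ (metricForm g c) c.target := by
  rw [contDiffOn_clm_apply]
  intro v
  rw [contDiffOn_clm_apply]
  intro w
  -- With g as the inner product of the tangent bundle, the coefficients are inner products of
  -- smooth sections.
  let _ : Bundle.RiemannianBundle (fun z : Z => TangentSpace (𝓡 N) z) := ⟨g.toRiemannianMetric⟩
  have h : ContMDiffOn 𝓘(ℝ, Euc N) 𝓘(ℝ, ℝ) ∞ (fun y => metricForm g c y v w) c.target :=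
    ContMDiffOn.inner_bundle (IB := 𝓡 N) (F := Euc N) (E := fun z : Z => TangentSpace (𝓡 N) z)
    (b := c.symm) (v := fun y => chartDeriv c y v) (w := fun y => chartDeriv c y w)
    (contMDiffOn_chartDeriv hc v) (contMDiffOn_chartDeriv hc w)
  exact h.contDiffOn

end Metric

theorem euc_sum_single {N : ℕ} (v : Euc N) : v = ∑ i, v i • EuclideanSpace.single i (1 : ℝ) := by
  ext j
  simp [Finset.sum_apply, Pi.single_apply]

/-! ### Transition maps between charts of the maximal atlas -/

section Transition

variable {N : ℕ} {Z : Type*} [TopologicalSpace Z] [ChartedSpace (Euc N) Z]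
  [IsManifold (𝓡 N) ∞ Z] {c c' : OpenPartialHomeomorph Z (Euc N)}

omit [IsManifold (𝓡 N) ∞ Z] in
theorem contDiffAt_transition (hc : c ∈ IsManifold.maximalAtlas (𝓡 N) ∞ Z)
    (hc' : c' ∈ IsManifold.maximalAtlas (𝓡 N) ∞ Z) {y : Euc N} (hy : y ∈ c.target)
    (hy' : c.symm y ∈ c'.source) : ContDiffAt ℝ ∞ (c' ∘ c.symm) y := by
  have h1 : ContMDiffAt 𝓘(ℝ, Euc N) (𝓡 N) ∞ c.symm y :=
    (contMDiffOn_symm_of_mem_maximalAtlas hc).contMDiffAt (c.open_target.mem_nhds hy)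
  have h2 : ContMDiffAt (𝓡 N) 𝓘(ℝ, Euc N) ∞ c' (c.symm y) :=
    (contMDiffOn_of_mem_maximalAtlas hc').contMDiffAt (c'.open_source.mem_nhds hy')
  exact (h2.comp y h1).contDiffAt

omit [IsManifold (𝓡 N) ∞ Z] in
theorem mdifferentiableAt_symm_of_maximalAtlas (hc : c ∈ IsManifold.maximalAtlas (𝓡 N) ∞ Z)
    {y : Euc N} (hy : y ∈ c.target) : MDifferentiableAt 𝓘(ℝ, Euc N) (𝓡 N) c.symm y :=
  ((contMDiffOn_symm_of_mem_maximalAtlas hc).contMDiffAt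
    (c.open_target.mem_nhds hy)).mdifferentiableAt (by simp)

omit [ChartedSpace (Euc N) Z] [IsManifold (𝓡 N) ∞ Z] in
theorem eventually_mem_of_transition {y : Euc N} (hy : y ∈ c.target)
    (hy' : c.symm y ∈ c'.source) : ∀ᶠ w in 𝓝 y, w ∈ c.target ∧ c.symm w ∈ c'.source := by
  filter_upwards [c.open_target.mem_nhds hy,
    (c.continuousAt_symm hy).eventually (c'.open_source.mem_nhds hy')] with w h1 h2
  exact ⟨h1, h2⟩

omit [IsManifold (𝓡 N) ∞ Z] in
theorem chartDeriv_transition (hc : c ∈ IsManifold.maximalAtlas (𝓡 N) ∞ Z)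
    (hc' : c' ∈ IsManifold.maximalAtlas (𝓡 N) ∞ Z) {y : Euc N} (hy : y ∈ c.target)
    (hy' : c.symm y ∈ c'.source) (v : Euc N) :
    chartDeriv c y v = chartDeriv c' (c' (c.symm y)) (fderiv ℝ (c' ∘ c.symm) y v) := by
  have h : c.symm =ᶠ[𝓝 y] c'.symm ∘ (c' ∘ c.symm) := by
    filter_upwards [eventually_mem_of_transition hy hy'] with w hw
    simp [hw.2]
  have h1 : MDifferentiableAt 𝓘(ℝ, Euc N) 𝓘(ℝ, Euc N) (c' ∘ c.symm) y :=
    ((contDiffAt_transition hc hc' hy hy').differentiableAt (by simp)).mdifferentiableAt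
  have h2 := mfderiv_comp (I := 𝓘(ℝ, Euc N)) (I' := 𝓘(ℝ, Euc N)) (I'' := 𝓡 N) y
    (g := c'.symm) (f := c' ∘ c.symm)
    (mdifferentiableAt_symm_of_maximalAtlas hc' (c'.map_source hy')) h1
  have h3 := h.mfderiv_eq (I := 𝓘(ℝ, Euc N)) (I' := 𝓡 N)
  have h4 := h3.trans h2
  rw [mfderiv_eq_fderiv] at h4
  exact congrArg (fun L : Euc N →L[ℝ] Euc N => L v) h4

omit [IsManifold (𝓡 N) ∞ Z] in
-- Tangent vectors at a point are identified with the model space through the preferred chart there,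
-- so the manifold derivative of an inverse chart is the ordinary derivative of a transition map.
-- This is the bridge from tangent vectors to calculus in ℝ^N.
theorem chartDeriv_eq_fderiv {y : Euc N}
    (hd : MDifferentiableAt 𝓘(ℝ, Euc N) (𝓡 N) c.symm y) :
    chartDeriv c y = fderiv ℝ (chartAt (Euc N) (c.symm y) ∘ c.symm) y := by
  have h : mfderiv 𝓘(ℝ, Euc N) (𝓡 N) c.symm y = fderivWithin ℝ
      (writtenInExtChartAt 𝓘(ℝ, Euc N) (𝓡 N) y c.symm) (Set.range 𝓘(ℝ, Euc N))
      (extChartAt 𝓘(ℝ, Euc N) y y) := if_pos hd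
  refine h.trans ?_
  simp [writtenInExtChartAt, extChartAt, OpenPartialHomeomorph.extend, Function.comp_def]
  rfl

omit [IsManifold (𝓡 N) ∞ Z] in
theorem fderiv_transition_inverse (hc : c ∈ IsManifold.maximalAtlas (𝓡 N) ∞ Z)
    (hc' : c' ∈ IsManifold.maximalAtlas (𝓡 N) ∞ Z) {y : Euc N} (hy : y ∈ c.target)
    (hy' : c.symm y ∈ c'.source) (v : Euc N) :
    fderiv ℝ (c ∘ c'.symm) (c' (c.symm y)) (fderiv ℝ (c' ∘ c.symm) y v) = v := by
  have h : (c ∘ c'.symm) ∘ (c' ∘ c.symm) =ᶠ[𝓝 y] id := by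
    filter_upwards [eventually_mem_of_transition hy hy'] with w hw
    simp [hw.1, hw.2]
  have h1 := (contDiffAt_transition hc hc' hy hy').differentiableAt (by simp)
  have h2 : DifferentiableAt ℝ (c ∘ c'.symm) (c' (c.symm y)) :=
    (contDiffAt_transition hc' hc (c'.map_source hy')
      (by rw [c'.left_inv hy']; exact c.map_target hy)).differentiableAt (by simp)
  have h3 := (fderiv_comp y h2 h1).symm.trans h.fderiv_eq
  rw [fderiv_id] at h3
  exact congrArg (fun L : Euc N →L[ℝ] Euc N => L v) h3

omit [IsManifold (𝓡 N) ∞ Z] in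
theorem fderiv_transition_surjective (hc : c ∈ IsManifold.maximalAtlas (𝓡 N) ∞ Z)
    (hc' : c' ∈ IsManifold.maximalAtlas (𝓡 N) ∞ Z) {y : Euc N} (hy : y ∈ c.target)
    (hy' : c.symm y ∈ c'.source) (v : Euc N) :
    fderiv ℝ (c' ∘ c.symm) y (fderiv ℝ (c ∘ c'.symm) (c' (c.symm y)) v) = v := by
  have := fderiv_transition_inverse hc' hc (c'.map_source hy')
    (by rw [c'.left_inv hy']; exact c.map_target hy) v
  rwa [c'.left_inv hy', c.right_inv hy] at this

theorem chartDeriv_injective (hc : c ∈ IsManifold.maximalAtlas (𝓡 N) ∞ Z) {y : Euc N}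
    (hy : y ∈ c.target) : Function.Injective (chartDeriv c y) := by
  have hm := IsManifold.chart_mem_maximalAtlas (I := 𝓡 N) (n := ∞) (c.symm y)
  intro v w hvw
  rw [chartDeriv_eq_fderiv (mdifferentiableAt_symm_of_maximalAtlas hc hy)] at hvw
  rw [← fderiv_transition_inverse hc hm hy (mem_chart_source _ _) v, hvw,
    fderiv_transition_inverse hc hm hy (mem_chart_source _ _) w]

end Transition

/-! ### Christoffel symbols as a bilinear form: Koszul formula, smoothness, transformation law -/

section Christoffel

variable {N : ℕ} {Z : Type*} [TopologicalSpace Z] [ChartedSpace (Euc N) Z]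
  [IsManifold (𝓡 N) ∞ Z] (g : RiemMetric N Z) {c c' : OpenPartialHomeomorph Z (Euc N)}

theorem metricForm_pos (hc : c ∈ IsManifold.maximalAtlas (𝓡 N) ∞ Z) {y : Euc N}
    (hy : y ∈ c.target) {v : Euc N} (hv : v ≠ 0) : 0 < metricForm g c y v v :=
  g.pos _ _ fun h => hv (chartDeriv_injective hc hy (h.trans (map_zero (chartDeriv c y)).symm))

theorem metricForm_apply (y v w : Euc N) :
    metricForm g c y v w = (g.inner (c.symm y) : Euc N →L[ℝ] Euc N →L[ℝ] ℝ) (chartDeriv c y v)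
      (chartDeriv c y w) := rfl

theorem metricForm_transition (hc : c ∈ IsManifold.maximalAtlas (𝓡 N) ∞ Z)
    (hc' : c' ∈ IsManifold.maximalAtlas (𝓡 N) ∞ Z) {y : Euc N} (hy : y ∈ c.target)
    (hy' : c.symm y ∈ c'.source) (v w : Euc N) :
    metricForm g c y v w = metricForm g c' ((c' ∘ c.symm) y)
      (fderiv ℝ (c' ∘ c.symm) y v) (fderiv ℝ (c' ∘ c.symm) y w) := by
  -- The base points on the two sides are equal but not by definition; `key` moves the metric from
  -- one to the other while the components stay fixed.
  have key : ∀ (z z' : Z), z = z' → ∀ v w : Euc N,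
      (g.inner z : Euc N →L[ℝ] Euc N →L[ℝ] ℝ) v w =
        (g.inner z' : Euc N →L[ℝ] Euc N →L[ℝ] ℝ) v w := by
    rintro z _ rfl v w; rfl
  have h1 := key (c.symm y) (c'.symm (c' (c.symm y))) (by simp [hy']) (chartDeriv c y v)
    (chartDeriv c y w)
  rw [chartDeriv_transition hc hc' hy hy' v, chartDeriv_transition hc hc' hy hy' w] at h1
  rw [metricForm_apply, chartDeriv_transition hc hc' hy hy' v,
    chartDeriv_transition hc hc' hy hy' w]
  exact h1

/-- The Christoffel symbols of a chart as a vector valued bilinear form. -/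
noncomputable def christoffelForm (c : OpenPartialHomeomorph Z (Euc N)) (y : Euc N) :
    Euc N →L[ℝ] Euc N →L[ℝ] Euc N :=
  ∑ k, ∑ i, ∑ j, christoffel g c y k i j •
    (EuclideanSpace.proj i : Euc N →L[ℝ] ℝ).smulRight
      ((EuclideanSpace.proj j : Euc N →L[ℝ] ℝ).smulRight (EuclideanSpace.single k (1 : ℝ) : Euc N))

theorem christoffelForm_apply (y v w : Euc N) (k : Fin N) :
    christoffelForm g c y v w k = ∑ p, ∑ q, christoffel g c y k p q * v p * w q := by
  simp [christoffelForm, Finset.sum_apply, Pi.single_apply, mul_assoc]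

theorem differentiableAt_metricForm (hc : c ∈ IsManifold.maximalAtlas (𝓡 N) ∞ Z) {y : Euc N}
    (hy : y ∈ c.target) : DifferentiableAt ℝ (metricForm g c) y :=
  ((contDiffOn_metricForm g hc).contDiffAt (c.open_target.mem_nhds hy)).differentiableAt (by simp)

theorem metricDeriv_eq (hc : c ∈ IsManifold.maximalAtlas (𝓡 N) ∞ Z) {y : Euc N}
    (hy : y ∈ c.target) (l i j : Fin N) :
    metricDeriv g c y l i j = fderiv ℝ (metricForm g c) y (EuclideanSpace.single l 1)
      (EuclideanSpace.single i 1) (EuclideanSpace.single j 1) := by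
  have hd := differentiableAt_metricForm g hc hy
  simp only [metricDeriv, metricCoeff_eq]
  have h1 := (hd.hasFDerivAt.clm_apply (hasFDerivAt_const (EuclideanSpace.single i 1 : Euc N) y))
  have h2 := (h1.clm_apply (hasFDerivAt_const (EuclideanSpace.single j 1 : Euc N) y))
  rw [h2.fderiv]
  simp

/-- A kernel vector of the Gram matrix would be a nonzero vector of zero length. -/
theorem metricCoeff_det_isUnit (hc : c ∈ IsManifold.maximalAtlas (𝓡 N) ∞ Z) {y : Euc N}
    (hy : y ∈ c.target) : IsUnit (metricCoeff g c y).det := by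
  rw [isUnit_iff_ne_zero]
  intro h0
  obtain ⟨v, hv, hv0⟩ := Matrix.exists_mulVec_eq_zero_iff.2 h0
  have hne : (WithLp.toLp 2 v : Euc N) ≠ 0 := by
    intro h; exact hv (by simpa using h)
  have hpos := metricForm_pos g hc hy hne
  have : metricForm g c y (WithLp.toLp 2 v) (WithLp.toLp 2 v) = v ⬝ᵥ (metricCoeff g c y *ᵥ v) := by
    conv_lhs => rw [euc_sum_single (WithLp.toLp 2 v : Euc N)]
    simp only [map_sum, map_smul, sum_apply, smul_apply, ← metricCoeff_eq, dotProduct,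
      Matrix.mulVec, smul_eq_mul, Finset.mul_sum]
    refine Finset.sum_congr rfl fun i _ => Finset.sum_congr rfl fun j _ => ?_
    rw [metricCoeff_eq, metricForm_symm, ← metricCoeff_eq]
    ring
  rw [this, hv0] at hpos
  simp at hpos

/-- The Koszul formula for the coordinate fields of a chart. -/
theorem metricForm_christoffelForm (hc : c ∈ IsManifold.maximalAtlas (𝓡 N) ∞ Z) {y : Euc N}
    (hy : y ∈ c.target) (v w t : Euc N) :
    metricForm g c y (christoffelForm g c y v w) t =
      (1 / 2) * (fderiv ℝ (metricForm g c) y v w t + fderiv ℝ (metricForm g c) y w v t -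
        fderiv ℝ (metricForm g c) y t v w) := by
  refine koszul_of_basis (EuclideanSpace.basisFun (Fin N) ℝ).toBasis (fun i j l => ?_) v w t
  simp only [OrthonormalBasis.coe_toBasis, EuclideanSpace.basisFun_apply]
  rw [euc_sum_single (christoffelForm g c y _ _)]
  have h1 : ∀ k, christoffelForm g c y (EuclideanSpace.single i 1) (EuclideanSpace.single j 1) k =
      christoffel g c y k i j := by
    intro k
    rw [christoffelForm_apply]
    simp
  simp only [map_sum, map_smul, sum_apply, smul_apply,
    ← metricCoeff_eq, smul_eq_mul, h1, ← metricDeriv_eq g hc hy]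
  -- Lowering the upper index of Γ with the metric cancels the inverse matrix in its definition and
  -- leaves the Koszul expression.
  have hM := Matrix.mul_nonsing_inv _ (metricCoeff_det_isUnit g hc hy)
  have hM' : ∀ m, ∑ k, metricCoeff g c y l k * (metricCoeff g c y)⁻¹ k m =
      if l = m then 1 else 0 := by
    intro m
    rw [← Matrix.mul_apply, hM, Matrix.one_apply]
  simp only [christoffel, mul_assoc, Finset.sum_mul, ← Finset.mul_sum]
  rw [Finset.sum_comm]
  congr 1
  calc _ = ∑ m, (∑ k, metricCoeff g c y l k * (metricCoeff g c y)⁻¹ k m) *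
        (metricDeriv g c y i j m + metricDeriv g c y j i m - metricDeriv g c y m i j) := by
        refine Finset.sum_congr rfl fun m _ => ?_
        rw [Finset.sum_mul]
        refine Finset.sum_congr rfl fun k _ => ?_
        rw [metricCoeff_eq g c y k l, metricForm_symm, ← metricCoeff_eq]
        ring
    _ = _ := by simp [hM']

theorem contDiffOn_metricCoeff (hc : c ∈ IsManifold.maximalAtlas (𝓡 N) ∞ Z) (i j : Fin N) :
    ContDiffOn ℝ ∞ (fun y => metricCoeff g c y i j) c.target :=
  ((contDiffOn_metricForm g hc).clm_apply contDiffOn_const).clm_apply contDiffOn_const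

theorem contDiffOn_metricDeriv (hc : c ∈ IsManifold.maximalAtlas (𝓡 N) ∞ Z) (l i j : Fin N) :
    ContDiffOn ℝ ∞ (fun y => metricDeriv g c y l i j) c.target :=
  ((contDiffOn_metricCoeff g hc i j).fderiv_of_isOpen (m := ∞) c.open_target (by simp)).clm_apply
    contDiffOn_const

theorem contDiffOn_det {E : Type*} [NormedAddCommGroup E] [NormedSpace ℝ E] {s : Set E} {k : ℕ∞ω}
    {A : E → Matrix (Fin N) (Fin N) ℝ} (hA : ∀ i j, ContDiffOn ℝ k (fun y => A y i j) s) :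
    ContDiffOn ℝ k (fun y => (A y).det) s := by
  simp only [Matrix.det_apply]
  exact ContDiffOn.sum fun σ _ => (contDiffOn_prod fun i _ => hA _ _).const_smul _

/-- Cramer's rule: the entries of the inverse are cofactors over the determinant. -/
theorem contDiffOn_matrix_inv {E : Type*} [NormedAddCommGroup E] [NormedSpace ℝ E] {s : Set E}
    {k : ℕ∞ω} {A : E → Matrix (Fin N) (Fin N) ℝ} (hA : ∀ i j, ContDiffOn ℝ k (fun y => A y i j) s)
    (hu : ∀ y ∈ s, IsUnit (A y).det) (i j : Fin N) :
    ContDiffOn ℝ k (fun y => (A y)⁻¹ i j) s := by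
  simp only [Matrix.inv_def, Ring.inverse_eq_inv', Matrix.smul_apply, Matrix.adjugate_apply,
    smul_eq_mul]
  refine ((contDiffOn_det hA).inv fun y hy => (hu y hy).ne_zero).mul (contDiffOn_det fun p q => ?_)
  simp only [Matrix.updateRow_apply]
  split_ifs
  · exact contDiffOn_const
  · exact hA _ _

theorem contDiffOn_christoffelForm (hc : c ∈ IsManifold.maximalAtlas (𝓡 N) ∞ Z) :
    ContDiffOn ℝ ∞ (christoffelForm g c) c.target := by
  have h : ∀ k i j, ContDiffOn ℝ ∞ (fun y => christoffel g c y k i j) c.target := fun k i j =>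
    contDiffOn_const.mul <| ContDiffOn.sum fun l _ =>
      (contDiffOn_matrix_inv (contDiffOn_metricCoeff g hc)
        (fun y hy => metricCoeff_det_isUnit g hc hy) k l).mul
      (((contDiffOn_metricDeriv g hc i j l).add (contDiffOn_metricDeriv g hc j i l)).sub
        (contDiffOn_metricDeriv g hc l i j))
  rw [contDiffOn_clm_apply]
  intro v
  rw [contDiffOn_clm_apply]
  intro w
  rw [contDiffOn_euclidean]
  intro k
  simp only [christoffelForm_apply]
  exact ContDiffOn.sum fun i _ => ContDiffOn.sum fun j _ =>
    ((h k i j).mul contDiffOn_const).mul contDiffOn_const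

/-- The transformation law of the Christoffel symbols. -/
theorem christoffelForm_transition (hc : c ∈ IsManifold.maximalAtlas (𝓡 N) ∞ Z)
    (hc' : c' ∈ IsManifold.maximalAtlas (𝓡 N) ∞ Z) {y : Euc N} (hy : y ∈ c.target)
    (hy' : c.symm y ∈ c'.source) (v w : Euc N) :
    fderiv ℝ (c' ∘ c.symm) y (christoffelForm g c y v w) =
      christoffelForm g c' ((c' ∘ c.symm) y) (fderiv ℝ (c' ∘ c.symm) y v)
        (fderiv ℝ (c' ∘ c.symm) y w) + fderiv ℝ (fderiv ℝ (c' ∘ c.symm)) y v w := by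
  have hψy : (c' ∘ c.symm) y ∈ c'.target := c'.map_source hy'
  refine christoffel_transition_of_koszul
    ((contDiffAt_transition hc hc' hy hy').of_le ENat.LEInfty.out)
    (differentiableAt_metricForm g hc hy) (differentiableAt_metricForm g hc' hψy) ?_
    (metricForm_symm g c' _) (fun _ h => metricForm_pos g hc' hψy h)
    (fun v => ⟨_, fderiv_transition_surjective hc hc' hy hy' v⟩)
    (metricForm_christoffelForm g hc hy) (metricForm_christoffelForm g hc' hψy) v w
  filter_upwards [eventually_mem_of_transition hy hy'] with x hx
  exact metricForm_transition g hc hc' hx.1 hx.2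

end Christoffel

/-! ### 2-jets in an arbitrary chart -/

section Sums

variable {N : ℕ}

theorem sum_mul_clm_single (L : Euc N →L[ℝ] ℝ) (v : Euc N) :
    ∑ k, v k * L (EuclideanSpace.single k 1) = L v := by
  conv_rhs => rw [euc_sum_single v]
  simp only [map_sum, map_smul, smul_eq_mul]

/-- Turns the matrix congruence in `Jet.act` into the evaluation of a bilinear form on frame
vectors. -/
theorem mul_mul_transpose_apply_of_bilin (H M : Matrix (Fin N) (Fin N) ℝ)
    (B : Euc N →L[ℝ] Euc N →L[ℝ] ℝ) (e : Fin N → Euc N) (hH : ∀ i k, H i k = e i k)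
    (hM : ∀ k l, M k l = B (EuclideanSpace.single k 1) (EuclideanSpace.single l 1)) (i j : Fin N) :
    (H * M * Hᵀ) i j = B (e i) (e j) := by
  rw [← sum_mul_clm_single (B (e i)) (e j)]
  simp only [Matrix.mul_apply, Matrix.transpose_apply, hH, hM]
  refine Finset.sum_congr rfl fun l _ => ?_
  rw [mul_comm]
  congr 1
  conv_rhs => rw [euc_sum_single (e i)]
  simp only [map_sum, map_smul, sum_apply, smul_apply, smul_eq_mul]

end Sums

section Jets

variable {N : ℕ} {Z : Type*} [TopologicalSpace Z] [ChartedSpace (Euc N) Z]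

variable [IsManifold (𝓡 N) ∞ Z] {c : OpenPartialHomeomorph Z (Euc N)}

omit [IsManifold (𝓡 N) ∞ Z] in
theorem chartDeriv_eq_fderiv_chartAt (hc : c ∈ IsManifold.maximalAtlas (𝓡 N) ∞ Z) {z : Z}
    (hz : z ∈ c.source) :
    chartDeriv c (c z) = fderiv ℝ (chartAt (Euc N) z ∘ c.symm) (c z) := by
  rw [chartDeriv_eq_fderiv (mdifferentiableAt_symm_of_maximalAtlas hc (c.map_source hz)),
    c.left_inv hz]

theorem contDiffAt_chartAt_comp (hc : c ∈ IsManifold.maximalAtlas (𝓡 N) ∞ Z) {z : Z}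
    (hz : z ∈ c.source) : ContDiffAt ℝ 2 (chartAt (Euc N) z ∘ c.symm) (c z) :=
  (contDiffAt_transition hc (IsManifold.chart_mem_maximalAtlas z) (c.map_source hz)
    (by rw [c.left_inv hz]; exact mem_chart_source _ _)).of_le ENat.LEInfty.out

omit [IsManifold (𝓡 N) ∞ Z] in
theorem comp_symm_eventuallyEq_inChart (φ : Z → ℝ) {z : Z} (hz : z ∈ c.source) :
    φ ∘ c.symm =ᶠ[𝓝 (c z)] inChart (N := N) φ z ∘ (chartAt (Euc N) z ∘ c.symm) := by
  filter_upwards [eventually_mem_of_transition (c' := chartAt (Euc N) z) (c.map_source hz)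
    (by rw [c.left_inv hz]; exact mem_chart_source _ _)] with w hw
  simp [inChart, hw.2]

theorem contDiffAt_comp_symm (hc : c ∈ IsManifold.maximalAtlas (𝓡 N) ∞ Z) {z : Z}
    (hz : z ∈ c.source) {φ : Z → ℝ} (hφ : C2At (N := N) φ z) :
    ContDiffAt ℝ 2 (φ ∘ c.symm) (c z) := by
  refine ContDiffAt.congr_of_eventuallyEq ?_ (comp_symm_eventuallyEq_inChart φ hz)
  refine ContDiffAt.comp _ ?_ (contDiffAt_chartAt_comp hc hz)
  simpa [c.left_inv hz] using contDiffAt_inChart hφ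

theorem fderiv_comp_symm (hc : c ∈ IsManifold.maximalAtlas (𝓡 N) ∞ Z) {z : Z}
    (hz : z ∈ c.source) {φ : Z → ℝ} (hφ : C2At (N := N) φ z) (v : Euc N) :
    fderiv ℝ (φ ∘ c.symm) (c z) v =
      fderiv ℝ (inChart (N := N) φ z) (chartAt (Euc N) z z)
        (fderiv ℝ (chartAt (Euc N) z ∘ c.symm) (c z) v) := by
  have h0 : (chartAt (Euc N) z ∘ c.symm) (c z) = chartAt (Euc N) z z := by
    simp [c.left_inv hz]
  have h1 := (contDiffAt_inChart hφ).differentiableAt (by simp)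
  rw [← h0] at h1
  rw [(comp_symm_eventuallyEq_inChart φ hz).fderiv_eq, fderiv_comp _ h1
    ((contDiffAt_chartAt_comp hc hz).differentiableAt (by simp)), h0]
  rfl

theorem fderiv_fderiv_comp_symm (hc : c ∈ IsManifold.maximalAtlas (𝓡 N) ∞ Z) {z : Z}
    (hz : z ∈ c.source) {φ : Z → ℝ} (hφ : C2At (N := N) φ z) (v w : Euc N) :
    fderiv ℝ (fderiv ℝ (φ ∘ c.symm)) (c z) v w =
      fderiv ℝ (fderiv ℝ (inChart (N := N) φ z)) (chartAt (Euc N) z z)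
        (fderiv ℝ (chartAt (Euc N) z ∘ c.symm) (c z) v)
        (fderiv ℝ (chartAt (Euc N) z ∘ c.symm) (c z) w) +
      fderiv ℝ (inChart (N := N) φ z) (chartAt (Euc N) z z)
        (fderiv ℝ (fderiv ℝ (chartAt (Euc N) z ∘ c.symm)) (c z) v w) := by
  have h0 : (chartAt (Euc N) z ∘ c.symm) (c z) = chartAt (Euc N) z z := by
    simp [c.left_inv hz]
  have h1 := contDiffAt_inChart hφ
  rw [← h0] at h1
  rw [(comp_symm_eventuallyEq_inChart φ hz).fderiv.fderiv_eq,
    fderiv_fderiv_comp h1 (contDiffAt_chartAt_comp hc hz), h0]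

omit [IsManifold (𝓡 N) ∞ Z] in
theorem c2At_comp_chart (hc : c ∈ IsManifold.maximalAtlas (𝓡 N) ∞ Z) {z : Z}
    (hz : z ∈ c.source) {q : Euc N → ℝ} (hq : ContDiffAt ℝ 2 q (c z)) :
    C2At (N := N) (q ∘ c) z := by
  have h2 : ContMDiffAt (𝓡 N) 𝓘(ℝ, Euc N) 2 c z :=
    ((contMDiffOn_of_mem_maximalAtlas hc).contMDiffAt (c.open_source.mem_nhds hz)).of_le
      ENat.LEInfty.out
  exact hq.contMDiffAt.comp z h2

omit [ChartedSpace (Euc N) Z] [IsManifold (𝓡 N) ∞ Z] in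
theorem comp_chart_eventuallyEq {z : Z} (hz : z ∈ c.source) (q : Euc N → ℝ) :
    (q ∘ c) ∘ c.symm =ᶠ[𝓝 (c z)] q := by
  filter_upwards [c.open_target.mem_nhds (c.map_source hz)] with w hw
  simp [hw]

end Jets

/-! ### Gradients and Hessians in a frame -/

section Frames

variable {N : ℕ} {Z : Type*} [TopologicalSpace Z] [ChartedSpace (Euc N) Z]
  [IsManifold (𝓡 N) ∞ Z] (g : RiemMetric N Z) {c : OpenPartialHomeomorph Z (Euc N)}

theorem christoffelForm_symm (y v w : Euc N) :
    christoffelForm g c y v w = christoffelForm g c y w v := by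
  ext k
  rw [christoffelForm_apply, christoffelForm_apply, Finset.sum_comm]
  refine Finset.sum_congr rfl fun i _ => Finset.sum_congr rfl fun j _ => ?_
  rw [christoffel_symm]
  ring

theorem jetInFrame_grad (z : Z) (e : Fin N → Euc N) (φ : Z → ℝ) (hφ : C2At (N := N) φ z)
    (i : Fin N) : (jetInFrame g z e (jet φ z hφ)).2.1 i =
      fderiv ℝ (inChart (N := N) φ z) (chartAt (Euc N) z z) (e i) :=
  sum_mul_clm_single _ _

theorem jetInFrame_hess (z : Z) (e : Fin N → Euc N) (φ : Z → ℝ) (hφ : C2At (N := N) φ z)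
    (i j : Fin N) : (jetInFrame g z e (jet φ z hφ)).2.2.1 i j =
      fderiv ℝ (fderiv ℝ (inChart (N := N) φ z)) (chartAt (Euc N) z z) (e i) (e j) -
      fderiv ℝ (inChart (N := N) φ z) (chartAt (Euc N) z z)
        (christoffelForm g (chartAt (Euc N) z) (chartAt (Euc N) z z) (e i) (e j)) := by
  refine mul_mul_transpose_apply_of_bilin (frameMatrix z e) (riemannianJet g z (jet φ z hφ)).2.2.1
    (fderiv ℝ (fderiv ℝ (inChart (N := N) φ z)) (chartAt (Euc N) z z) -
      (ContinuousLinearMap.compL ℝ (Euc N) (Euc N) ℝ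
        (fderiv ℝ (inChart (N := N) φ z) (chartAt (Euc N) z z))).comp
        (christoffelForm g (chartAt (Euc N) z) (chartAt (Euc N) z z)))
    e (fun _ _ => rfl) (fun k l => ?_) i j
  refine congrArg₂ (fun a b : ℝ => a - b) rfl ?_
  rw [Matrix.of_apply]
  have h := sum_mul_clm_single (fderiv ℝ (inChart (N := N) φ z) (chartAt (Euc N) z z))
    (christoffelForm g (chartAt (Euc N) z) (chartAt (Euc N) z z) (EuclideanSpace.single k 1)
      (EuclideanSpace.single l 1))
  refine Eq.trans (Finset.sum_congr rfl fun m _ => ?_) h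
  rw [christoffelForm_apply]
  congr 1
  simp

variable (hc : c ∈ IsManifold.maximalAtlas (𝓡 N) ∞ Z)
include hc

/-- The gradient of a function in a frame, in any chart. -/
theorem jetInFrame_grad_chart {z : Z} (hz : z ∈ c.source) {e ε : Fin N → Euc N}
    (he : ∀ i, e i = chartDeriv c (c z) (ε i)) (φ : Z → ℝ) (hφ : C2At (N := N) φ z) (i : Fin N) :
    (jetInFrame g z e (jet φ z hφ)).2.1 i = fderiv ℝ (φ ∘ c.symm) (c z) (ε i) := by
  rw [jetInFrame_grad, fderiv_comp_symm hc hz hφ, he, chartDeriv_eq_fderiv_chartAt hc hz]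

/-- The Hessian of a function in a frame, in any chart. -/
theorem jetInFrame_hess_chart {z : Z} (hz : z ∈ c.source) {e ε : Fin N → Euc N}
    (he : ∀ i, e i = chartDeriv c (c z) (ε i)) (φ : Z → ℝ) (hφ : C2At (N := N) φ z)
    (i j : Fin N) : (jetInFrame g z e (jet φ z hφ)).2.2.1 i j =
      fderiv ℝ (fderiv ℝ (φ ∘ c.symm)) (c z) (ε i) (ε j) -
      fderiv ℝ (φ ∘ c.symm) (c z) (christoffelForm g c (c z) (ε i) (ε j)) := by
  -- The second derivative of the transition map appears both in the chain rule for D²φ and in the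
  -- transformation law of Γ; the two occurrences cancel.
  have h := christoffelForm_transition g hc (IsManifold.chart_mem_maximalAtlas z)
    (c.map_source hz) (by rw [c.left_inv hz]; exact mem_chart_source _ _) (ε i) (ε j)
  have h0 : (chartAt (Euc N) z ∘ c.symm) (c z) = chartAt (Euc N) z z := by
    simp [c.left_inv hz]
  rw [h0] at h
  rw [jetInFrame_hess, fderiv_fderiv_comp_symm hc hz hφ, fderiv_comp_symm hc hz hφ, h,
    he, he, chartDeriv_eq_fderiv_chartAt hc hz, map_add]
  ring

omit hc in
theorem isOrthonormalFrame_iff {z : Z} (hz : z ∈ c.source) {e ε : Fin N → Euc N}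
    (he : ∀ i, e i = chartDeriv c (c z) (ε i)) :
    IsOrthonormalFrame g z e ↔
      ∀ i j, metricForm g c (c z) (ε i) (ε j) = if i = j then 1 else 0 := by
  have key : ∀ (z z' : Z), z = z' → ∀ v w : Euc N,
      (g.inner z : Euc N →L[ℝ] Euc N →L[ℝ] ℝ) v w =
        (g.inner z' : Euc N →L[ℝ] Euc N →L[ℝ] ℝ) v w := by
    rintro z _ rfl v w; rfl
  refine forall₂_congr fun i j => ?_
  have h : metricForm g c (c z) (ε i) (ε j) = g.inner z (e i) (e j) := by
    rw [metricForm_apply, ← he, ← he]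
    exact key _ _ (c.left_inv hz) _ _
  rw [h]

omit hc in
theorem linearIndependent_of_orthonormal {y : Euc N} {ε : Fin N → Euc N}
    (hε : ∀ i j, metricForm g c y (ε i) (ε j) = if i = j then 1 else 0) :
    LinearIndependent ℝ ε := by
  rw [Fintype.linearIndependent_iff]
  intro a ha i
  have h := congrArg (fun v => metricForm g c y v (ε i)) ha
  simpa [map_sum, sum_apply, hε] using h

/-- Every element of `J²_N` is the 2-jet of a function in a given frame. -/
theorem exists_jetInFrame_eq {z : Z} (hz : z ∈ c.source) {e ε : Fin N → Euc N}
    (he : ∀ i, e i = chartDeriv c (c z) (ε i)) (hli : LinearIndependent ℝ ε) (K : Jet N) :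
    ∃ (φ : Z → ℝ) (hφ : C2At (N := N) φ z), jetInFrame g z e (jet φ z hφ) = K := by
  let b : Module.Basis (Fin N) ℝ (Euc N) :=
    basisOfLinearIndependentOfCardEqFinrank' ε hli (by simp)
  have hb : ∀ i, b i = ε i := fun i => by simp [b]
  let p : Euc N →L[ℝ] ℝ := (b.constr ℝ K.2.1).toContinuousLinearMap
  have hp : ∀ i, p (ε i) = K.2.1 i := fun i => by simp [p, ← hb]
  -- The coordinate second derivative is the desired Hessian plus the term p(Γ) that the Riemannian
  -- Hessian subtracts; it is symmetric because Γ is.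
  let A : Euc N →L[ℝ] Euc N →L[ℝ] ℝ := (Matrix.toBilin b (Matrix.of fun i j =>
    K.2.2.1 i j + p (christoffelForm g c (c z) (ε i) (ε j)))).toContinuousBilinearMap
  have hA : ∀ i j, A (ε i) (ε j) = K.2.2.1 i j + p (christoffelForm g c (c z) (ε i) (ε j)) := by
    intro i j
    rw [← hb i, ← hb j]
    change Matrix.toBilin b _ (b i) (b j) = _
    rw [Matrix.toBilin_apply]
    simp only [Module.Basis.repr_self]
    simp [Finsupp.single_apply, hb]
  have hsymm : ∀ v w, A v w = A w v := by
    intro v w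
    induction v using basis_induction b with
    | hadd v v' h h' => simp only [map_add, add_apply, h, h']
    | hsmul r v h => simp only [map_smul, smul_apply, h]
    | h0 => simp
    | hb i =>
    induction w using basis_induction b with
    | hadd v v' h h' => simp only [map_add, add_apply, h, h']
    | hsmul r v h => simp only [map_smul, smul_apply, h]
    | h0 => simp
    | hb j =>
    rw [hb, hb, hA, hA, christoffelForm_symm, K.2.2.2.apply]
  obtain ⟨q, hq, hq0, hq1, hq2⟩ := exists_contDiff_jet_eq K.1 p A hsymm (c z)
  have hφ := c2At_comp_chart hc hz hq.contDiffAt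
  have heq := comp_chart_eventuallyEq hz q
  refine ⟨q ∘ c, hφ, Prod.ext hq0 (Prod.ext ?_ (Subtype.ext ?_))⟩
  · ext i
    rw [jetInFrame_grad_chart g hc hz he, heq.fderiv_eq, hq1, hp]
  · ext i j
    rw [jetInFrame_hess_chart g hc hz he, heq.fderiv_eq, heq.fderiv.fderiv_eq, hq1, hq2, hA]
    ring

end Frames

/-! ### Charts adapted to a submanifold -/

section Adapted

variable {n N : ℕ} {Z : Type*} [TopologicalSpace Z] [ChartedSpace (Euc N) Z]
  {X : Type*} [TopologicalSpace X] [ChartedSpace (Euc n) X]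

variable (n N) in
/-- Charts of `X` near `x` and of `Z` near `i x` in which `i` is a linear inclusion `ι`,
together with a linear projection `π` onto the submanifold. -/
structure AdaptedCharts (i : X → Z) (x : X) where
  d : OpenPartialHomeomorph X (Euc n)
  c : OpenPartialHomeomorph Z (Euc N)
  hd : d ∈ IsManifold.maximalAtlas (𝓡 n) ∞ X
  hc : c ∈ IsManifold.maximalAtlas (𝓡 N) ∞ Z
  mem_d : x ∈ d.source
  ι : Euc n →L[ℝ] Euc N
  π : Euc N →L[ℝ] Euc n
  π_ι : ∀ s, π (ι s) = s
  map_mem : ∀ y ∈ d.source, i y ∈ c.source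
  map_eq : ∀ y ∈ d.source, c (i y) = ι (d y)

/-- The local normal form of an immersion: up to a linear isomorphism, i reads s ↦ (s, 0), and π is
the first component. -/
theorem exists_adaptedCharts {i : X → Z} (hi : Manifold.IsSmoothEmbedding (𝓡 n) (𝓡 N) ∞ i)
    (x : X) : Nonempty (AdaptedCharts n N i x) := by
  have h := hi.isImmersion.isImmersionAt x
  refine ⟨⟨h.domChart, h.codChart, h.domChart_mem_maximalAtlas, h.codChart_mem_maximalAtlas,
    h.mem_domChart_source,
    (h.equiv : _ →L[ℝ] Euc N).comp (ContinuousLinearMap.inl ℝ (Euc n) h.complement),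
    (ContinuousLinearMap.fst ℝ (Euc n) h.complement).comp (h.equiv.symm : Euc N →L[ℝ] _),
    fun s => by simp, fun y hy => h.source_subset_preimage_source hy, fun y hy => ?_⟩⟩
  have hm : h.domChart y ∈ (h.domChart.extend (𝓡 n)).target := by
    simpa using h.domChart.map_source hy
  simpa [hy] using h.writtenInCharts hm

namespace AdaptedCharts

variable {i : X → Z} {x : X} (A : AdaptedCharts n N i x)

/-- The component of a vector normal to the submanifold, in adapted charts. -/
def Q : Euc N →L[ℝ] Euc N := ContinuousLinearMap.id ℝ (Euc N) - A.ι.comp A.π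

theorem Q_apply (v : Euc N) : A.Q v = v - A.ι (A.π v) := rfl

theorem Q_ι (s : Euc n) : A.Q (A.ι s) = 0 := by
  rw [Q_apply, A.π_ι, sub_self]

theorem eq_ι_of_Q_eq_zero {v : Euc N} (hv : A.Q v = 0) : v = A.ι (A.π v) := by
  rwa [Q_apply, sub_eq_zero] at hv

theorem mem_c : i x ∈ A.c.source := A.map_mem x A.mem_d

theorem map_base : A.c (i x) = A.ι (A.d x) := A.map_eq x A.mem_d

/-- A chart at another point of the domain of the adapted charts. -/
def move {y : X} (hy : y ∈ A.d.source) : AdaptedCharts n N i y :=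
  { A with mem_d := hy }

theorem comp_symm_eventuallyEq (φ : Z → ℝ) :
    (φ ∘ i) ∘ A.d.symm =ᶠ[𝓝 (A.d x)] (φ ∘ A.c.symm) ∘ A.ι := by
  filter_upwards [A.d.open_target.mem_nhds (A.d.map_source A.mem_d)] with w hw
  have h := A.map_eq _ (A.d.map_target hw)
  rw [A.d.right_inv hw] at h
  simp only [Function.comp]
  rw [← h, A.c.left_inv (A.map_mem _ (A.d.map_target hw))]

theorem c2At_comp [IsManifold (𝓡 N) ∞ Z] (A : AdaptedCharts n N i x) {φ : Z → ℝ}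
    (hφ : C2At (N := N) φ (i x)) : C2At (N := n) (φ ∘ i) x := by
  have h1 : ContDiffAt ℝ 2 ((φ ∘ A.c.symm) ∘ A.ι) (A.d x) := by
    refine ContDiffAt.comp _ ?_ A.ι.contDiff.contDiffAt
    rw [← A.map_base]
    exact contDiffAt_comp_symm A.hc A.mem_c hφ
  have h2 := c2At_comp_chart A.hd A.mem_d (h1.congr_of_eventuallyEq (A.comp_symm_eventuallyEq φ))
  refine h2.congr_of_eventuallyEq ?_
  filter_upwards [A.d.open_source.mem_nhds A.mem_d] with y hy
  simp [hy]

variable [IsManifold (𝓡 N) ∞ Z]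

theorem fderiv_comp_symm_eq {φ : Z → ℝ} (hφ : C2At (N := N) φ (i x)) (s : Euc n) :
    fderiv ℝ ((φ ∘ i) ∘ A.d.symm) (A.d x) s = fderiv ℝ (φ ∘ A.c.symm) (A.c (i x)) (A.ι s) := by
  have h := (contDiffAt_comp_symm A.hc A.mem_c hφ).differentiableAt (by simp)
  rw [A.map_base] at h ⊢
  rw [(A.comp_symm_eventuallyEq φ).fderiv_eq, fderiv_comp_clm A.ι h]

theorem fderiv_fderiv_comp_symm_eq {φ : Z → ℝ} (hφ : C2At (N := N) φ (i x)) (s t : Euc n) :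
    fderiv ℝ (fderiv ℝ ((φ ∘ i) ∘ A.d.symm)) (A.d x) s t =
      fderiv ℝ (fderiv ℝ (φ ∘ A.c.symm)) (A.c (i x)) (A.ι s) (A.ι t) := by
  have h := contDiffAt_comp_symm A.hc A.mem_c hφ
  rw [A.map_base] at h ⊢
  rw [(A.comp_symm_eventuallyEq φ).fderiv.fderiv_eq, fderiv_fderiv_comp_clm A.ι h]

variable [IsManifold (𝓡 n) ∞ X]

omit [IsManifold (𝓡 N) ∞ Z] [IsManifold (𝓡 n) ∞ X] in
theorem mapInCharts_eventuallyEq : mapInCharts (N := N) (n := n) i x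
    =ᶠ[𝓝 (chartAt (Euc n) x x)]
      (chartAt (Euc N) (i x) ∘ A.c.symm) ∘ (A.ι ∘ (A.d ∘ (chartAt (Euc n) x).symm)) := by
  have h : (chartAt (Euc n) x).symm (chartAt (Euc n) x x) ∈ A.d.source := by
    rw [(chartAt (Euc n) x).left_inv (mem_chart_source _ _)]; exact A.mem_d
  filter_upwards [eventually_mem_of_transition (mem_chart_target (Euc n) x) h] with w hw
  simp only [mapInCharts, Function.comp]
  rw [← A.map_eq _ hw.2, A.c.left_inv (A.map_mem _ hw.2)]

/-- The second fundamental form of a totally geodesic submanifold vanishes in adapted charts. -/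
theorem Q_christoffelForm_base {g : RiemMetric N Z} (hgeo : IsTotallyGeodesic (n := n) g i)
    (s t : Euc n) : A.Q (christoffelForm g A.c (A.c (i x)) (A.ι s) (A.ι t)) = 0 := by
  set c' := chartAt (Euc N) (i x)
  set d' := chartAt (Euc n) x
  set f : Euc n → Euc N := mapInCharts i x with hf
  set θ := A.d ∘ d'.symm with hθ
  set ψ := c' ∘ A.c.symm with hψ
  have hd' : d' ∈ IsManifold.maximalAtlas (𝓡 n) ∞ X := IsManifold.chart_mem_maximalAtlas x
  have hc' : c' ∈ IsManifold.maximalAtlas (𝓡 N) ∞ Z := IsManifold.chart_mem_maximalAtlas (i x)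
  have hx : d' x ∈ d'.target := mem_chart_target (Euc n) x
  have hx' : d'.symm (d' x) = x := d'.left_inv (mem_chart_source _ _)
  have hxd : d'.symm (d' x) ∈ A.d.source := by rw [hx']; exact A.mem_d
  have hy : A.c (i x) ∈ A.c.target := A.c.map_source A.mem_c
  have hyc : A.c.symm (A.c (i x)) ∈ c'.source := by
    rw [A.c.left_inv A.mem_c]; exact mem_chart_source _ _
  have hψy : ψ (A.c (i x)) = c' (i x) := by simp [hψ, A.c.left_inv A.mem_c]
  have hθ2 : ContDiffAt ℝ 2 θ (d' x) :=
    (contDiffAt_transition hd' A.hd hx hxd).of_le ENat.LEInfty.out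
  have hψ2 : ContDiffAt ℝ 2 ψ (A.c (i x)) :=
    (contDiffAt_transition A.hc hc' hy hyc).of_le ENat.LEInfty.out
  have hιθ : (A.ι ∘ θ) (d' x) = A.c (i x) := by
    simp [hθ, hx', A.map_base]
  have hιθ2 : ContDiffAt ℝ 2 (A.ι ∘ θ) (d' x) := A.ι.contDiff.contDiffAt.comp _ hθ2
  have hDιθ : ∀ v, fderiv ℝ (A.ι ∘ θ) (d' x) v = A.ι (fderiv ℝ θ (d' x) v) := by
    intro v
    rw [fderiv_comp _ A.ι.differentiableAt (hθ2.differentiableAt (by simp))]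
    simp
  have heq := A.mapInCharts_eventuallyEq
  have hDf : ∀ v, fderiv ℝ f (d' x) v =
      fderiv ℝ ψ (A.c (i x)) (A.ι (fderiv ℝ θ (d' x) v)) := by
    intro v
    rw [heq.fderiv_eq, fderiv_comp _ (by rw [hιθ]; exact hψ2.differentiableAt (by simp))
      (hιθ2.differentiableAt (by simp)), hιθ, ContinuousLinearMap.comp_apply, hDιθ]
  have hD2f : ∀ v w, fderiv ℝ (fderiv ℝ f) (d' x) v w =
      fderiv ℝ (fderiv ℝ ψ) (A.c (i x)) (A.ι (fderiv ℝ θ (d' x) v)) (A.ι (fderiv ℝ θ (d' x) w)) +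
      fderiv ℝ ψ (A.c (i x)) (A.ι (fderiv ℝ (fderiv ℝ θ) (d' x) v w)) := by
    intro v w
    rw [heq.fderiv.fderiv_eq, fderiv_fderiv_comp (by rw [hιθ]; exact hψ2) hιθ2, hιθ,
      fderiv_fderiv_clm_comp A.ι hθ2, hDιθ, hDιθ]
  -- Total geodesy is given on coordinate vectors only. It extends bilinearly because the range of
  -- Df is a subspace.
  have hrange : ∀ v w, fderiv ℝ (fderiv ℝ f) (d' x) v w +
      christoffelForm g c' (c' (i x)) (fderiv ℝ f (d' x) v) (fderiv ℝ f (d' x) w) ∈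
        (fderiv ℝ f (d' x) : Euc n →ₗ[ℝ] Euc N).range := by
    intro v w
    induction v using basis_induction (EuclideanSpace.basisFun (Fin n) ℝ).toBasis with
    | hadd v v' h h' =>
      convert Submodule.add_mem _ h h' using 1
      simp only [map_add, add_apply]; abel
    | hsmul r v h =>
      convert Submodule.smul_mem _ r h using 1
      simp only [map_smul, smul_apply, smul_add]
    | h0 => simp
    | hb a =>
    induction w using basis_induction (EuclideanSpace.basisFun (Fin n) ℝ).toBasis with
    | hadd v v' h h' =>
      convert Submodule.add_mem _ h h' using 1
      simp only [map_add]; abel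
    | hsmul r v h =>
      convert Submodule.smul_mem _ r h using 1
      simp only [map_smul, smul_add]
    | h0 => simp
    | hb b =>
    obtain ⟨τ, hτ⟩ := hgeo x a b
    refine ⟨τ, ?_⟩
    simp only [OrthonormalBasis.coe_toBasis, EuclideanSpace.basisFun_apply]
    refine hτ.trans ?_
    congr 1
    ext k
    rw [christoffelForm_apply]
  obtain ⟨v, rfl⟩ : ∃ v, fderiv ℝ θ (d' x) v = s :=
    ⟨_, fderiv_transition_surjective hd' A.hd hx hxd s⟩
  obtain ⟨w, rfl⟩ : ∃ v, fderiv ℝ θ (d' x) v = t :=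
    ⟨_, fderiv_transition_surjective hd' A.hd hx hxd t⟩
  obtain ⟨τ, hτ⟩ := hrange v w
  have htr := christoffelForm_transition g A.hc hc' hy hyc (A.ι (fderiv ℝ θ (d' x) v))
    (A.ι (fderiv ℝ θ (d' x) w))
  rw [← hψ, hψy] at htr
  -- By the transformation law, Γ in the adapted chart is carried by Dψ to Γ + D²ψ in the preferred
  -- one. As f = ψ ∘ ι ∘ θ, this is D²f + Γ(Df, Df) up to the tangent vector Dψ ι D²θ, hence again
  -- tangent; Dψ is then inverted.
  have hfin : fderiv ℝ ψ (A.c (i x)) (christoffelForm g A.c (A.c (i x))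
      (A.ι (fderiv ℝ θ (d' x) v)) (A.ι (fderiv ℝ θ (d' x) w))) =
      fderiv ℝ ψ (A.c (i x)) (A.ι (fderiv ℝ θ (d' x) τ - fderiv ℝ (fderiv ℝ θ) (d' x) v w)) := by
    rw [htr, map_sub, map_sub, ← hDf τ]
    have hτ' : fderiv ℝ f (d' x) τ = _ := hτ
    rw [hτ', hD2f, hDf, hDf]
    abel
  have hinj := congrArg (fderiv ℝ (A.c ∘ c'.symm) (c' (A.c.symm (A.c (i x))))) hfin
  rw [fderiv_transition_inverse A.hc hc' hy hyc, fderiv_transition_inverse A.hc hc' hy hyc] at hinj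
  rw [hinj, Q_ι]

/-- The same charts are adapted at every point of X in their domain, so the statement at the base
point can be recentred. -/
theorem Q_christoffelForm {g : RiemMetric N Z} (hgeo : IsTotallyGeodesic (n := n) g i)
    {y : Euc n} (hy : y ∈ A.d.target) (s t : Euc n) :
    A.Q (christoffelForm g A.c (A.ι y) (A.ι s) (A.ι t)) = 0 := by
  have h := (A.move (A.d.map_target hy)).Q_christoffelForm_base hgeo s t
  have h2 : A.c (i (A.d.symm y)) = A.ι y := by
    rw [A.map_eq _ (A.d.map_target hy), A.d.right_inv hy]
  rw [← h2]
  exact h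

/-- The convergence of the tangential parts of jets at `i x` in a frame whose first `n` vectors are
tangent to `X` implies the convergence of the restricted jets. -/
theorem tendsto_jet_comp {g : RiemMetric N Z} (hgeo : IsTotallyGeodesic (n := n) g i) (hn : n ≤ N)
    {e ε : Fin N → Euc N} (he : ∀ k, e k = chartDeriv A.c (A.c (i x)) (ε k))
    (t : Module.Basis (Fin n) ℝ (Euc n)) (ht : ∀ a, ε (Fin.castLE hn a) = A.ι (t a))
    {φ : ℕ → Z → ℝ} {Φ : Z → ℝ} (hφ : ∀ j, C2At (N := N) (φ j) (i x)) (hΦ : C2At (N := N) Φ (i x))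
    (hψ : ∀ j, C2At (N := n) (φ j ∘ i) x) (hΨ : C2At (N := n) (Φ ∘ i) x)
    (h : Tendsto (fun j => Jet.restrict hn (jetInFrame g (i x) e (jet (φ j) (i x) (hφ j)))) atTop
      (𝓝 (Jet.restrict hn (jetInFrame g (i x) e (jet Φ (i x) hΦ))))) :
    Tendsto (fun j => jet (φ j ∘ i) x (hψ j)) atTop (𝓝 (jet (Φ ∘ i) x hΨ)) := by
  -- The correction term of the tangential Hessian is then a derivative along X, already controlled
  -- by the gradient part.
  have hΓ : ∀ a b, ∃ s, christoffelForm g A.c (A.c (i x)) (A.ι (t a)) (A.ι (t b)) = A.ι s :=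
    fun a b => ⟨_, A.eq_ι_of_Q_eq_zero (A.Q_christoffelForm_base hgeo _ _)⟩
  have hcomp : ∀ f : Jet n → ℝ, Continuous f →
      Tendsto (fun j => f (Jet.restrict hn (jetInFrame g (i x) e (jet (φ j) (i x) (hφ j))))) atTop
        (𝓝 (f (Jet.restrict hn (jetInFrame g (i x) e (jet Φ (i x) hΦ))))) :=
    fun f hf => (hf.tendsto _).comp h
  have h0 : Tendsto (fun j => φ j (i x)) atTop (𝓝 (Φ (i x))) := (continuous_fst.tendsto _).comp h
  have h1 : ∀ a, Tendsto (fun j => fderiv ℝ ((φ j ∘ i) ∘ A.d.symm) (A.d x) (t a)) atTop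
      (𝓝 (fderiv ℝ ((Φ ∘ i) ∘ A.d.symm) (A.d x) (t a))) := by
    intro a
    have hcont : Continuous fun J : Jet n => J.2.1 a := by fun_prop
    have := hcomp _ hcont
    simp only [Jet.restrict, jetInFrame_grad_chart g A.hc A.mem_c he, ht] at this
    simpa only [A.fderiv_comp_symm_eq (hφ _), A.fderiv_comp_symm_eq hΦ] using this
  have h1' : ∀ s, Tendsto (fun j => fderiv ℝ ((φ j ∘ i) ∘ A.d.symm) (A.d x) s) atTop
      (𝓝 (fderiv ℝ ((Φ ∘ i) ∘ A.d.symm) (A.d x) s)) := by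
    intro s
    induction s using basis_induction t with
    | hadd v w hv hw => simpa only [map_add] using hv.add hw
    | hsmul r v hv => simpa only [map_smul] using hv.const_smul r
    | h0 => simp
    | hb a => exact h1 a
  have h2 : ∀ a b, Tendsto (fun j => fderiv ℝ (fderiv ℝ ((φ j ∘ i) ∘ A.d.symm)) (A.d x) (t a) (t b))
      atTop (𝓝 (fderiv ℝ (fderiv ℝ ((Φ ∘ i) ∘ A.d.symm)) (A.d x) (t a) (t b))) := by
    intro a b
    obtain ⟨s, hs⟩ := hΓ a b
    have hcont : Continuous fun J : Jet n => J.2.2.1 a b :=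
      (continuous_subtype_val.comp (continuous_snd.comp continuous_snd)).matrix_elem a b
    have := hcomp _ hcont
    simp only [Jet.restrict, Matrix.submatrix_apply,
      jetInFrame_hess_chart g A.hc A.mem_c he, ht, hs, ← A.fderiv_comp_symm_eq (hφ _),
      ← A.fderiv_comp_symm_eq hΦ, ← A.fderiv_fderiv_comp_symm_eq (hφ _),
      ← A.fderiv_fderiv_comp_symm_eq hΦ] at this
    simpa using this.add (h1' s)
  have h2' : ∀ s r, Tendsto (fun j => fderiv ℝ (fderiv ℝ ((φ j ∘ i) ∘ A.d.symm)) (A.d x) s r)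
      atTop (𝓝 (fderiv ℝ (fderiv ℝ ((Φ ∘ i) ∘ A.d.symm)) (A.d x) s r)) := by
    intro s r
    induction s using basis_induction t with
    | hadd v w hv hw => simpa only [map_add, add_apply] using hv.add hw
    | hsmul r v hv => simpa only [map_smul, smul_apply] using hv.const_smul r
    | h0 => simp
    | hb a =>
    induction r using basis_induction t with
    | hadd v w hv hw => simpa only [map_add] using hv.add hw
    | hsmul r v hv => simpa only [map_smul] using hv.const_smul r
    | h0 => simp
    | hb b => exact h2 a b
  -- Pass from the adapted chart of X to the preferred one, in which `jet` is written; the chain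
  -- rule's extra first-order term converges too and is subtracted.
  have hsurj : ∀ w, ∃ v, fderiv ℝ (chartAt (Euc n) x ∘ A.d.symm) (A.d x) v = w := fun w =>
    ⟨_, fderiv_transition_surjective A.hd (IsManifold.chart_mem_maximalAtlas x)
      (A.d.map_source A.mem_d) (by rw [A.d.left_inv A.mem_d]; exact mem_chart_source _ _) w⟩
  have h3 : ∀ w, Tendsto (fun j => fderiv ℝ (inChart (N := n) (φ j ∘ i) x) (chartAt (Euc n) x x) w)
      atTop (𝓝 (fderiv ℝ (inChart (N := n) (Φ ∘ i) x) (chartAt (Euc n) x x) w)) := by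
    intro w
    obtain ⟨v, rfl⟩ := hsurj w
    simpa only [← fderiv_comp_symm A.hd A.mem_d (hψ _), ← fderiv_comp_symm A.hd A.mem_d hΨ]
      using h1' v
  refine h0.prodMk_nhds (Tendsto.prodMk_nhds ?_ ?_)
  · rw [tendsto_pi_nhds]
    exact fun a => h3 _
  · rw [tendsto_subtype_rng]
    refine tendsto_pi_nhds.2 fun a => tendsto_pi_nhds.2 fun b => ?_
    obtain ⟨v, hv⟩ := hsurj (EuclideanSpace.single a 1)
    obtain ⟨w, hw⟩ := hsurj (EuclideanSpace.single b 1)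
    have h4 := (h2' v w).sub
      (h3 (fderiv ℝ (fderiv ℝ (chartAt (Euc n) x ∘ A.d.symm)) (A.d x) v w))
    simp only [fderiv_fderiv_comp_symm A.hd A.mem_d (hψ _),
      fderiv_fderiv_comp_symm A.hd A.mem_d hΨ, add_sub_cancel_right, hv, hw] at h4
    exact h4

end AdaptedCharts

end Adapted

/-! ### Estimates near the submanifold and orthonormal frames -/

section Estimates

variable {E : Type*} [NormedAddCommGroup E] [NormedSpace ℝ E]

/-- The minimum on the unit sphere gives the bound at a, and continuity costs half of it nearby.
Applied to the metric, it bounds orthonormal frames uniformly, so that they have convergent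
subsequences. -/
theorem exists_coercive_bound [FiniteDimensional ℝ E] {B : E → E →L[ℝ] E →L[ℝ] ℝ} {a : E}
    (hB : ContinuousAt B a) (hpos : ∀ v, v ≠ 0 → 0 < B a v v) :
    ∃ m > 0, ∀ᶠ y in 𝓝 a, ∀ v, m * ‖v‖ ^ 2 ≤ B y v v := by
  obtain ⟨m, hm, hmB⟩ : ∃ m > 0, ∀ v, m * ‖v‖ ^ 2 ≤ B a v v := by
    rcases subsingleton_or_nontrivial E with hE | hE
    · exact ⟨1, one_pos, fun v => by simp [Subsingleton.elim v 0]⟩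
    · have : ProperSpace E := FiniteDimensional.proper_real E
      have hcont : Continuous fun v => B a v v := by fun_prop
      obtain ⟨v₀, hv₀, hmin⟩ := (isCompact_sphere (0 : E) 1).exists_isMinOn
        (NormedSpace.sphere_nonempty.2 zero_le_one) hcont.continuousOn
      have hne : v₀ ≠ 0 := fun h => by simp [h] at hv₀
      refine ⟨B a v₀ v₀, hpos v₀ hne, fun v => ?_⟩
      rcases eq_or_ne v 0 with rfl | hv
      · simp
      · have hv' : ‖v‖ ≠ 0 := norm_ne_zero_iff.2 hv
        have h1 : (‖v‖⁻¹ • v) ∈ Metric.sphere (0 : E) 1 := by simp [norm_smul, hv']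
        have h2 := hmin h1
        simp only [Set.mem_ofPred_eq, map_smul, smul_apply, smul_eq_mul] at h2
        calc B a v₀ v₀ * ‖v‖ ^ 2 ≤ (‖v‖⁻¹ * (‖v‖⁻¹ * B a v v)) * ‖v‖ ^ 2 := by gcongr
          _ = B a v v := by field_simp
  refine ⟨m / 2, by positivity, ?_⟩
  filter_upwards [(Metric.continuousAt_iff' (f := B)).1 hB (m / 2) (by positivity)] with y hy v
  have hy' : ‖B y - B a‖ < m / 2 := (dist_eq_norm (B y) (B a)).symm.trans_lt hy
  have h1 : |(B y - B a) v v| ≤ m / 2 * ‖v‖ * ‖v‖ :=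
    ((B y - B a).le_opNorm₂ v v).trans (by gcongr)
  have h2 : (B y - B a) v v = B y v v - B a v v := rfl
  have h3 := (abs_le.1 h1).1
  have h4 := hmB v
  rw [h2] at h3
  nlinarith

/-- A C¹ map is Lipschitz near a; compare y with its projection P y, where T ∘ f vanishes and whose
distance from y is ‖Q y‖. -/
theorem exists_bound_normal_component {F : Type*} [NormedAddCommGroup F] [NormedSpace ℝ F]
    {f : E → F} {P Q : E → E} {T : F →L[ℝ] F} {a : E} (hf : ContDiffAt ℝ 1 f a)
    (hP : ContinuousAt P a) (hPa : P a = a) (hPQ : ∀ y, y - P y = Q y)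
    (hT : ∀ᶠ y in 𝓝 a, T (f (P y)) = 0) :
    ∃ C, 0 ≤ C ∧ ∀ᶠ y in 𝓝 a, ‖T (f y)‖ ≤ C * ‖Q y‖ := by
  obtain ⟨K, s, hs, hK⟩ := hf.exists_lipschitzOnWith
  refine ⟨‖T‖ * K, by positivity, ?_⟩
  have hPs : ∀ᶠ y in 𝓝 a, P y ∈ s := hP.eventually (by rwa [hPa])
  filter_upwards [hs, hPs, hT] with y hy hy' hTy
  have h1 : T (f y) = T (f y - f (P y)) := by rw [map_sub, hTy, sub_zero]
  rw [h1, mul_assoc, ← hPQ]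
  exact (T.le_opNorm _).trans (by gcongr; exact hK.norm_sub_le hy hy')

/-- Telescope from Γ_y(v, w) to Γ_{Py}(Pv, Pw), which Q kills: each difference contains a factor y -
Py, Qv or Qw, all of order ‖Q y‖. -/
theorem exists_bound_bilinear_normal_component {Γ : E → E →L[ℝ] E →L[ℝ] E} {P Q : E →L[ℝ] E}
    {a : E} (hΓ : ContDiffAt ℝ 1 Γ a) (hPa : P a = a) (hPQ : ∀ y, y - P y = Q y)
    (h : ∀ᶠ y in 𝓝 a, ∀ v w, Q (Γ (P y) (P v) (P w)) = 0) {R C : ℝ} (hR : 0 ≤ R) (hC : 0 ≤ C) :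
    ∃ C', 0 ≤ C' ∧ ∀ᶠ y in 𝓝 a, ∀ v w, ‖v‖ ≤ R → ‖w‖ ≤ R → ‖Q v‖ ≤ C * ‖Q y‖ →
      ‖Q w‖ ≤ C * ‖Q y‖ → ‖Q (Γ y v w)‖ ≤ C' * ‖Q y‖ := by
  obtain ⟨K, s, hs, hK⟩ := hΓ.exists_lipschitzOnWith
  have hPc : ContinuousAt P a := P.continuous.continuousAt
  have hPs : ∀ᶠ y in 𝓝 a, P y ∈ s := hPc.eventually (by rwa [hPa])
  have hbd : ∀ᶠ y in 𝓝 a, ‖Γ (P y)‖ < ‖Γ a‖ + 1 := by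
    have : ContinuousAt (fun y => ‖Γ (P y)‖) a :=
      ContinuousAt.norm (f := fun y => Γ (P y))
        (ContinuousAt.comp (g := Γ) (by rw [hPa]; exact hΓ.continuousAt) hPc)
    have h2 := this.eventually (gt_mem_nhds (show ‖Γ (P a)‖ < ‖Γ a‖ + 1 by rw [hPa]; linarith))
    exact h2
  set M := ‖Γ a‖ + 1 with hM
  have hM0 : 0 ≤ M := by positivity
  refine ⟨‖Q‖ * (K * R * R + M * C * R + M * (‖P‖ * R) * C), by positivity, ?_⟩
  filter_upwards [hs, hPs, hbd, h] with y hy hy' hΓy hQ v w hv hw hQv hQw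
  have hdecomp : Γ y v w = (Γ y - Γ (P y)) v w + Γ (P y) (Q v) w + Γ (P y) (P v) (Q w) +
      Γ (P y) (P v) (P w) := by
    simp only [← hPQ, map_sub, sub_apply]
    abel
  have h1 : ‖(Γ y - Γ (P y)) v w‖ ≤ (K * R * R) * ‖Q y‖ := by
    calc _ ≤ ‖Γ y - Γ (P y)‖ * ‖v‖ * ‖w‖ := ContinuousLinearMap.le_opNorm₂ _ _ _
      _ ≤ (K * ‖y - P y‖) * R * R := by gcongr; exact hK.norm_sub_le hy hy'
      _ = _ := by rw [hPQ]; ring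
  have h2 : ‖Γ (P y) (Q v) w‖ ≤ (M * C * R) * ‖Q y‖ := by
    calc _ ≤ ‖Γ (P y)‖ * ‖Q v‖ * ‖w‖ := ContinuousLinearMap.le_opNorm₂ _ _ _
      _ ≤ M * (C * ‖Q y‖) * R := by gcongr
      _ = _ := by ring
  have h3 : ‖Γ (P y) (P v) (Q w)‖ ≤ (M * (‖P‖ * R) * C) * ‖Q y‖ := by
    calc _ ≤ ‖Γ (P y)‖ * ‖P v‖ * ‖Q w‖ := ContinuousLinearMap.le_opNorm₂ _ _ _
      _ ≤ M * (‖P‖ * R) * (C * ‖Q y‖) := by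
        gcongr
        exact (P.le_opNorm v).trans (by gcongr)
      _ = _ := by ring
  rw [hdecomp, map_add, hQ, add_zero]
  calc _ ≤ ‖Q‖ * ‖(Γ y - Γ (P y)) v w + Γ (P y) (Q v) w + Γ (P y) (P v) (Q w)‖ := Q.le_opNorm _
    _ ≤ ‖Q‖ * ((K * R * R) * ‖Q y‖ + (M * C * R) * ‖Q y‖ + (M * (‖P‖ * R) * C) * ‖Q y‖) := by
      gcongr
      exact (norm_add₃_le).trans (by gcongr)
    _ = _ := by ring

theorem tendsto_mul_of_abs_le {k f r : ℕ → ℝ} {C : ℝ} (hk : ∀ j, 0 ≤ k j)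
    (hr : Tendsto (fun j => k j * r j) atTop (𝓝 0)) (hf : ∀ j, |f j| ≤ C * r j) :
    Tendsto (fun j => k j * f j) atTop (𝓝 0) := by
  have h := hr.const_mul C
  rw [mul_zero] at h
  refine squeeze_zero_norm (fun j => ?_) h
  rw [Real.norm_eq_abs, abs_mul, abs_of_nonneg (hk j)]
  calc _ ≤ k j * (C * r j) := mul_le_mul_of_nonneg_left (hf j) (hk j)
    _ = _ := by ring

end Estimates

/-- For every inner product there is an orthonormal basis whose first vectors span a given
subspace. -/
theorem exists_orthonormal_adapted {n N : ℕ} (hn : n ≤ N) {V : Type*} [AddCommGroup V] [Module ℝ V]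
    [FiniteDimensional ℝ V] (B : V →ₗ[ℝ] V →ₗ[ℝ] ℝ) (hsymm : ∀ v w, B v w = B w v)
    (hpos : ∀ v, v ≠ 0 → 0 < B v v) (W : Submodule ℝ V) (hV : Module.finrank ℝ V = N)
    (hW : Module.finrank ℝ W = n) :
    ∃ ε : Fin N → V, (∀ i j, B (ε i) (ε j) = if i = j then 1 else 0) ∧
      ∀ a : Fin n, ε (Fin.castLE hn a) ∈ W := by
  let core : InnerProductSpace.Core ℝ V :=
    { inner := fun v w => B v w
      conj_inner_symm := fun v w => by simp [hsymm]
      re_inner_nonneg := fun v => by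
        rcases eq_or_ne v 0 with rfl | hv
        · simp
        · exact (hpos v hv).le
      add_left := fun v w t => by simp
      smul_left := fun v w r => by simp
      definite := fun v hv => by
        by_contra hne
        exact (hpos v hne).ne' hv }
  let _ : NormedAddCommGroup V := core.toNormedAddCommGroup
  let _ : InnerProductSpace ℝ V := InnerProductSpace.ofCore core.toCore
  let b : OrthonormalBasis (Fin n) ℝ W := (stdOrthonormalBasis ℝ W).reindex (finCongr hW)
  let v : Fin N → V := fun k => if hk : (k : ℕ) < n then b ⟨k, hk⟩ else 0
  have hv : Orthonormal ℝ (Set.domRestrict {k : Fin N | (k : ℕ) < n} v) := by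
    have h1 : Set.domRestrict {k : Fin N | (k : ℕ) < n} v =
        (fun a => (b a : V)) ∘ fun k : {k : Fin N | (k : ℕ) < n} => (⟨k, k.2⟩ : Fin n) := by
      ext k
      have hk : ((k : Fin N) : ℕ) < n := k.2
      simp [v, Set.domRestrict, hk]
    rw [h1]
    refine Orthonormal.comp (W.subtypeₗᵢ.orthonormal_comp_iff.2 b.orthonormal) _ ?_
    intro k l hkl
    exact Subtype.ext (Fin.ext (by simpa using hkl))
  obtain ⟨β, hβ⟩ := hv.exists_orthonormalBasis_extension_of_card_eq (by simpa using hV)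
  refine ⟨β, fun i j => ?_, fun a => ?_⟩
  · exact (orthonormal_iff_ite.1 β.orthonormal) i j
  · rw [hβ _ (show ((Fin.castLE hn a : Fin N) : ℕ) < n from a.2)]
    simp [v]

/-! ### Limits of jets of penalised test functions -/

theorem tendsto_jet {n : ℕ} {J : ℕ → Jet n} {K : Jet n}
    (h0 : Tendsto (fun j => (J j).1) atTop (𝓝 K.1))
    (h1 : ∀ a, Tendsto (fun j => (J j).2.1 a) atTop (𝓝 (K.2.1 a)))
    (h2 : ∀ a b, Tendsto (fun j => (J j).2.2.1 a b) atTop (𝓝 (K.2.2.1 a b))) :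
    Tendsto J atTop (𝓝 K) :=
  h0.prodMk_nhds (Tendsto.prodMk_nhds (tendsto_pi_nhds.2 h1)
    (tendsto_subtype_rng.2 (tendsto_pi_nhds.2 fun a => tendsto_pi_nhds.2 fun b => h2 a b)))

theorem tendsto_clm_apply {E F : Type*} [NormedAddCommGroup E] [NormedSpace ℝ E]
    [NormedAddCommGroup F] [NormedSpace ℝ F] {f : ℕ → E →L[ℝ] F} {f₀ : E →L[ℝ] F} {v : ℕ → E}
    {v₀ : E} (hf : Tendsto f atTop (𝓝 f₀)) (hv : Tendsto v atTop (𝓝 v₀)) :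
    Tendsto (fun j => f j (v j)) atTop (𝓝 (f₀ v₀)) :=
  ((isBoundedBilinearMap_apply (𝕜 := ℝ) (E := E) (F := F)).continuous.tendsto (f₀, v₀)).comp
    (hf.prodMk_nhds hv)

section Penalized

variable {E F : Type*} [NormedAddCommGroup E] [NormedSpace ℝ E] [NormedAddCommGroup F]
  [InnerProductSpace ℝ F] (Q : E →L[ℝ] F)

theorem contDiff_normSq_clm : ContDiff ℝ 2 (fun y => ‖Q y‖ ^ 2) :=
  Q.contDiff.norm_sq ℝ

theorem contDiffAt_penalized {α : E → ℝ} {y : E} (hα : ContDiffAt ℝ 2 α y) (k c : ℝ) :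
    ContDiffAt ℝ 2 (fun y => α y + k * ‖Q y‖ ^ 2 + c) y :=
  (hα.add (contDiffAt_const.mul (contDiff_normSq_clm Q).contDiffAt)).add contDiffAt_const

theorem fderiv_penalized {α : E → ℝ} {y : E} (hα : ContDiffAt ℝ 2 α y) (k c : ℝ) (v : E) :
    fderiv ℝ (fun y => α y + k * ‖Q y‖ ^ 2 + c) y v =
      fderiv ℝ α y v + k * (2 * inner ℝ (Q y) (Q v)) := by
  have hq := (contDiff_normSq_clm Q).differentiable (by simp) y
  rw [fderiv_add_const, fderiv_fun_add (hα.differentiableAt (by simp)) (hq.const_mul k),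
    fderiv_const_mul hq, add_apply, smul_apply, fderiv_normSq_clm, smul_eq_mul]

theorem fderiv_fderiv_penalized {α : E → ℝ} {y : E} (hα : ContDiffAt ℝ 2 α y) (k c : ℝ) (v w : E) :
    fderiv ℝ (fderiv ℝ (fun y => α y + k * ‖Q y‖ ^ 2 + c)) y v w =
      fderiv ℝ (fderiv ℝ α) y v w + k * (2 * inner ℝ (Q v) (Q w)) := by
  have hq := (contDiff_normSq_clm Q).contDiffAt (x := y)
  have h : (fun y => α y + k * ‖Q y‖ ^ 2) = α + k • fun y => ‖Q y‖ ^ 2 := rfl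
  have hkq : ContDiffAt ℝ 2 (k • fun y => ‖Q y‖ ^ 2) y := hq.const_smul k
  rw [fderiv_fderiv_add_const, h, fderiv_fderiv_add hα hkq,
    fderiv_fderiv_const_smul hq, add_apply, add_apply, smul_apply, smul_apply,
    fderiv_fderiv_normSq_clm, smul_eq_mul]

end Penalized

namespace AdaptedCharts

variable {n N : ℕ} {Z : Type*} [TopologicalSpace Z] [ChartedSpace (Euc N) Z]
  [IsManifold (𝓡 N) ∞ Z] {X : Type*} [TopologicalSpace X] [ChartedSpace (Euc n) X]
  [IsManifold (𝓡 n) ∞ X] {i : X → Z} {x : X} (A : AdaptedCharts n N i x)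

omit [IsManifold (𝓡 N) ∞ Z] [IsManifold (𝓡 n) ∞ X] in
theorem π_map_base : A.π (A.c (i x)) = A.d x := by rw [A.map_base, A.π_ι]

omit [IsManifold (𝓡 N) ∞ Z] [IsManifold (𝓡 n) ∞ X] in
theorem ι_π_map_base : A.ι (A.π (A.c (i x))) = A.c (i x) := by rw [π_map_base, A.map_base]

omit [IsManifold (𝓡 N) ∞ Z] [IsManifold (𝓡 n) ∞ X] in
theorem Q_map_base : A.Q (A.c (i x)) = 0 := by rw [A.map_base, Q_ι]

omit [IsManifold (𝓡 N) ∞ Z] [IsManifold (𝓡 n) ∞ X] in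
theorem eventually_π_mem : ∀ᶠ y in 𝓝 (A.c (i x)), A.π y ∈ A.d.target := by
  refine A.π.continuous.continuousAt.eventually ?_
  rw [π_map_base]
  exact A.d.open_target.mem_nhds (A.d.map_source A.mem_d)

omit [IsManifold (𝓡 N) ∞ Z] [IsManifold (𝓡 n) ∞ X] in
theorem symm_eq_of_Q_eq_zero {y : Euc N} (hy : A.π y ∈ A.d.target) (hQ : A.Q y = 0) :
    A.c.symm y = i (A.d.symm (A.π y)) := by
  have h := A.map_eq _ (A.d.map_target hy)
  rw [A.d.right_inv hy, ← A.eq_ι_of_Q_eq_zero hQ] at h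
  conv_lhs => rw [← h]
  exact A.c.left_inv (A.map_mem _ (A.d.map_target hy))

/-- The extension of a function on `X` to a neighbourhood in `Z` which is constant along the
normal directions of the adapted charts. -/
noncomputable def extend (φ : X → ℝ) : Z → ℝ := ((φ ∘ A.d.symm) ∘ A.π) ∘ A.c

omit [IsManifold (𝓡 N) ∞ Z] in
theorem contDiffAt_comp_π {φ : X → ℝ} (hφ : C2At (N := n) φ x) :
    ContDiffAt ℝ 2 ((φ ∘ A.d.symm) ∘ A.π) (A.c (i x)) := by
  refine ContDiffAt.comp _ ?_ A.π.contDiff.contDiffAt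
  rw [π_map_base]
  exact contDiffAt_comp_symm A.hd A.mem_d hφ

omit [IsManifold (𝓡 N) ∞ Z] in
theorem c2At_extend {φ : X → ℝ} (hφ : C2At (N := n) φ x) : C2At (N := N) (A.extend φ) (i x) :=
  c2At_comp_chart A.hc A.mem_c (A.contDiffAt_comp_π hφ)

omit [IsManifold (𝓡 N) ∞ Z] [IsManifold (𝓡 n) ∞ X] in
theorem extend_comp_eventuallyEq (φ : X → ℝ) : A.extend φ ∘ i =ᶠ[𝓝 x] φ := by
  filter_upwards [A.d.open_source.mem_nhds A.mem_d] with y hy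
  simp [extend, A.map_eq y hy, A.π_ι, hy]

variable {g : RiemMetric N Z}

/-- The key limit argument: if the test function `φ` touches `u ∘ i` from above at `x`, then
the tangential part of the jet of its extension, in a limit of the given frames, is a limit of
tangential parts of elements of `F`. -/
theorem exists_tangential_limit (hn : n ≤ N) (hgeo : IsTotallyGeodesic (n := n) g i)
    {F : Set (Jet N)} {Fs : Z → Set (Jet N)} {u : Z → EReal} (hu : IsSubharmonic Fs u)
    {E : Euc N → Fin N → Euc N}
    (hE : ∀ᶠ y in 𝓝 (A.c (i x)), ∀ k l,
      metricForm g A.c y (E y k) (E y l) = if k = l then 1 else 0)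
    {C : ℝ} (hC : 0 ≤ C) (hEQ : ∀ᶠ y in 𝓝 (A.c (i x)), ∀ a : Fin n,
      ‖A.Q (E y (Fin.castLE hn a))‖ ≤ C * ‖A.Q y‖)
    (hEF : ∀ᶠ y in 𝓝 (A.c (i x)), ∀ J ∈ Fs (A.c.symm y),
      jetInFrame g (A.c.symm y) (fun k => chartDeriv A.c y (E y k)) J ∈ F)
    {φ : X → ℝ} (hφ : C2At (N := n) φ x) (hle : ∀ᶠ y in 𝓝 x, (u ∘ i) y ≤ (φ y : EReal))
    (heq : (u ∘ i) x = (φ x : EReal)) :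
    ∃ (y : ℕ → Euc N) (ε : Fin N → Euc N), Tendsto y atTop (𝓝 (A.c (i x))) ∧
      Tendsto (fun j => E (y j)) atTop (𝓝 ε) ∧
      (∀ k l, metricForm g A.c (A.c (i x)) (ε k) (ε l) = if k = l then 1 else 0) ∧
      (∀ a : Fin n, A.Q (ε (Fin.castLE hn a)) = 0) ∧
      Jet.restrict hn (jetInFrame g (i x) (fun k => chartDeriv A.c (A.c (i x)) (ε k))
        (jet (A.extend φ) (i x) (A.c2At_extend hφ))) ∈ closure (Jet.restrict hn '' F) := by
  set a₀ := A.c (i x) with ha₀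
  have ha₀t : a₀ ∈ A.c.target := A.c.map_source A.mem_c
  have hsymm₀ : A.c.symm a₀ = i x := A.c.left_inv A.mem_c
  set α₀ : Euc N → ℝ := (φ ∘ A.d.symm) ∘ A.π with hα₀
  -- The fourth power makes the contact strict along X without changing the 2-jet at the base point;
  -- a square would alter the Hessian.
  set η : Euc N → ℝ := fun y => (‖A.π y - A.d x‖ ^ 2) ^ 2 with hη
  set α : Euc N → ℝ := α₀ + η with hα
  obtain ⟨hη2, hη0, hη0'⟩ := jet_normSq_sq A.π a₀ (A.d x) A.π_map_base
  have hα₀2 : ContDiffAt ℝ 2 α₀ a₀ := A.contDiffAt_comp_π hφ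
  have hα2 : ContDiffAt ℝ 2 α a₀ := hα₀2.add hη2.contDiffAt
  have hDα : fderiv ℝ α a₀ = fderiv ℝ α₀ a₀ := by
    rw [hα, fderiv_add (hα₀2.differentiableAt (by simp)) (hη2.differentiable (by simp) _), hη0,
      add_zero]
  have hD2α : fderiv ℝ (fderiv ℝ α) a₀ = fderiv ℝ (fderiv ℝ α₀) a₀ := by
    rw [hα, fderiv_fderiv_add hα₀2 hη2.contDiffAt, hη0', add_zero]
  have hα₀a : α₀ a₀ = φ x := by
    simp [hα₀, ha₀, A.π_map_base, A.mem_d]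
  have hαa : α a₀ = φ x := by
    have h : η a₀ = 0 := by simp [hη, ha₀, A.π_map_base]
    change α₀ a₀ + η a₀ = φ x
    rw [h, hα₀a, add_zero]
  have hle' : ∀ᶠ y in 𝓝 a₀, (u ∘ i) (A.d.symm (A.π y)) ≤ (α₀ y : EReal) := by
    have h1 : Tendsto (fun y => A.d.symm (A.π y)) (𝓝 a₀) (𝓝 x) := by
      have h2 := (A.d.continuousAt_symm (A.d.map_source A.mem_d)).tendsto
      rw [A.d.left_inv A.mem_d] at h2
      refine h2.comp ?_
      have h3 := A.π.continuous.tendsto a₀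
      rwa [ha₀, A.π_map_base] at h3
    exact h1.eventually hle
  obtain ⟨s, hs, hss⟩ := (((A.c.open_target.eventually_mem ha₀t).and A.eventually_π_mem).and
    (hle'.and (hα2.eventually (by simp)))).exists_mem
  obtain ⟨y, k, c, hy, hkq, hc, hk, hVy, hmax⟩ := exists_penalized_maxima (V := u ∘ A.c.symm)
    (α := α) (q := fun y => ‖A.Q y‖ ^ 2) hs
    (fun y hy =>
      UpperSemicontinuousAt.comp (hu.usc _) (A.c.continuousAt_symm (hss y hy).1.1))
    (fun y _ => hu.ne_top _) (fun y hy => (hss y hy).2.2.continuousAt.continuousWithinAt)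
    (by fun_prop) (fun y => by positivity)
    (by rw [hαa, ← heq]; simp only [Function.comp, hsymm₀]) (by simp [ha₀, A.Q_map_base])
    -- Where Q vanishes the point lies on X, so u ≤ φ applies, and η > 0 unless it is the base
    -- point.
    (fun y hys hQ hne => by
      have hQ0 : A.Q y = 0 := by simpa using hQ
      have h1 := (hss y hys).2.1
      simp only [Function.comp, A.symm_eq_of_Q_eq_zero (hss y hys).1.2 hQ0] at h1 ⊢
      refine h1.trans_lt ?_
      have hπ : A.π y ≠ A.d x := fun h => hne (by
        rw [A.eq_ι_of_Q_eq_zero hQ0, h, ha₀, A.map_base])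
      have hpos : 0 < η y := by
        have : 0 < ‖A.π y - A.d x‖ := norm_pos_iff.2 (sub_ne_zero.2 hπ)
        positivity
      exact_mod_cast (by simpa [hα] using hpos : α₀ y < α y))
  obtain ⟨m, hm, hcoer⟩ := exists_coercive_bound (B := metricForm g A.c) (a := a₀)
    ((contDiffOn_metricForm g A.hc).continuousOn.continuousAt (A.c.open_target.mem_nhds ha₀t))
    (fun v hv => metricForm_pos g A.hc ha₀t hv)
  set R := Real.sqrt (1 / m) with hR
  have hΓ1 : ContDiffAt ℝ 1 (christoffelForm g A.c) a₀ :=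
    ((contDiffOn_christoffelForm g A.hc).contDiffAt (A.c.open_target.mem_nhds ha₀t)).of_le
      ENat.LEInfty.out
  -- Total geodesy enters the estimate here: QΓ(E_a, E_b) = O(‖Q y‖).
  obtain ⟨C', hC', hΓ⟩ := exists_bound_bilinear_normal_component (Γ := christoffelForm g A.c)
    (P := A.ι.comp A.π) (Q := A.Q) hΓ1 A.ι_π_map_base (fun y => rfl)
    (A.eventually_π_mem.mono fun y hy v w => A.Q_christoffelForm hgeo hy _ _)
    (Real.sqrt_nonneg (1 / m)) hC
  have hnorm : ∀ᶠ y in 𝓝 a₀, ∀ k, ‖E y k‖ ≤ R := by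
    filter_upwards [hE, hcoer] with y hy hy' k
    have h1 := hy' (E y k)
    rw [hy k k, if_pos rfl] at h1
    refine Real.le_sqrt_of_sq_le ?_
    rw [le_div_iff₀ hm, mul_comm]
    exact h1
  obtain ⟨ρ, hρ, hall⟩ := extraction_of_eventually_atTop (hmax.and (hy.eventually
    (((A.c.open_target.eventually_mem ha₀t).and (hα2.eventually (by simp))).and
      ((hE.and hEQ).and ((hEF.and hΓ).and hnorm)))))
  -- E is not assumed continuous, so a limit frame is extracted by compactness.
  obtain ⟨ε, -, τ, hτ, hε⟩ := (isCompact_closedBall (0 : Fin N → Euc N) R).tendsto_subseq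
    (x := fun j => E (y (ρ j))) (fun j => by
      rw [mem_closedBall_zero_iff, pi_norm_le_iff_of_nonneg (Real.sqrt_nonneg _)]
      exact (hall j).2.2.2.2)
  set σ := ρ ∘ τ with hσ
  have hσt : Tendsto σ atTop atTop := hρ.tendsto_atTop.comp hτ.tendsto_atTop
  replace hall := fun j => hall (τ j)
  have hyσ : Tendsto (fun j => y (σ j)) atTop (𝓝 a₀) := hy.comp hσt
  have hkσ : Tendsto (fun j => k (σ j) * ‖A.Q (y (σ j))‖ ^ 2) atTop (𝓝 0) := hkq.comp hσt
  have hεk : ∀ k, Tendsto (fun j => E (y (σ j)) k) atTop (𝓝 (ε k)) := tendsto_pi_nhds.1 hε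
  have hεo : ∀ k l, metricForm g A.c a₀ (ε k) (ε l) = if k = l then 1 else 0 := by
    intro k l
    have h1 : Tendsto (fun j => metricForm g A.c (y (σ j))) atTop (𝓝 (metricForm g A.c a₀)) :=
      ((contDiffOn_metricForm g A.hc).continuousOn.continuousAt
        (A.c.open_target.mem_nhds ha₀t)).tendsto.comp hyσ
    have h2 := tendsto_clm_apply (tendsto_clm_apply h1 (hεk k)) (hεk l)
    refine tendsto_nhds_unique h2 ?_
    refine tendsto_const_nhds.congr fun j => ?_
    exact ((hall j).2.2.1.1 k l).symm
  have hεQ : ∀ a : Fin n, A.Q (ε (Fin.castLE hn a)) = 0 := by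
    intro a
    have h1 := ((A.Q.continuous.tendsto _).comp (hεk (Fin.castLE hn a))).norm
    have h2 : Tendsto (fun j => C * ‖A.Q (y (σ j))‖) atTop (𝓝 (C * ‖A.Q a₀‖)) :=
      (((A.Q.continuous.tendsto _).comp hyσ).norm).const_mul C
    rw [ha₀, A.Q_map_base, norm_zero, mul_zero] at h2
    have h3 := le_of_tendsto_of_tendsto h1 h2 (Eventually.of_forall fun j => (hall j).2.2.1.2 a)
    exact norm_le_zero_iff.1 h3
  refine ⟨fun j => y (σ j), ε, hyσ, hε, hεo, hεQ, ?_⟩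
  have hsrc : ∀ j, A.c.symm (y (σ j)) ∈ A.c.source := fun j => A.c.map_target (hall j).2.1.1
  have hcy : ∀ j, A.c (A.c.symm (y (σ j))) = y (σ j) := fun j => A.c.right_inv (hall j).2.1.1
  let T : ℕ → Euc N → ℝ := fun j y => α y + k (σ j) * ‖A.Q y‖ ^ 2 + c (σ j)
  have hT2 : ∀ j, ContDiffAt ℝ 2 (T j) (y (σ j)) := fun j =>
    contDiffAt_penalized A.Q (hall j).2.1.2 _ _
  have hDT : ∀ j v, fderiv ℝ (T j) (y (σ j)) v = fderiv ℝ α (y (σ j)) v +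
      k (σ j) * (2 * inner ℝ (A.Q (y (σ j))) (A.Q v)) := fun j v =>
    fderiv_penalized A.Q (hall j).2.1.2 _ _ v
  have hD2T : ∀ j v w, fderiv ℝ (fderiv ℝ (T j)) (y (σ j)) v w =
      fderiv ℝ (fderiv ℝ α) (y (σ j)) v w + k (σ j) * (2 * inner ℝ (A.Q v) (A.Q w)) :=
    fun j v w => fderiv_fderiv_penalized A.Q (hall j).2.1.2 _ _ v w
  have hTc : ∀ j, C2At (N := N) (T j ∘ A.c) (A.c.symm (y (σ j))) := fun j =>
    c2At_comp_chart A.hc (hsrc j) (by rw [hcy]; exact hT2 j)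
  -- The penalised function, shifted by the maximum, touches u from above on Z.
  have hTF : ∀ j, jet (T j ∘ A.c) (A.c.symm (y (σ j))) (hTc j) ∈ Fs (A.c.symm (y (σ j))) := by
    intro j
    refine hu.jet_mem _ _ (hTc j) ?_ ?_
    · have h1 := (A.c.continuousAt (hsrc j)).tendsto
      rw [hcy] at h1
      filter_upwards [h1.eventually (hall j).1, A.c.open_source.mem_nhds (hsrc j)] with z hz hz'
      have hz2 := hz
      simp only [Function.comp, A.c.left_inv hz'] at hz2
      exact hz2
    · have h1 := hVy (σ j)
      simp only [Function.comp, hcy]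
      exact h1
  refine mem_closure_of_tendsto (f := fun j => Jet.restrict hn (jetInFrame g
    (A.c.symm (y (σ j))) (fun k => chartDeriv A.c (y (σ j)) (E (y (σ j)) k))
    (jet (T j ∘ A.c) (A.c.symm (y (σ j))) (hTc j)))) (b := atTop) ?_
    (Eventually.of_forall fun j => ⟨_, (hall j).2.2.2.1.1 _ (hTF j), rfl⟩)
  have heTc : ∀ j, (T j ∘ A.c) ∘ A.c.symm =ᶠ[𝓝 (y (σ j))] T j := fun j => by
    have := comp_chart_eventuallyEq (hsrc j) (T j)
    rwa [hcy] at this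
  have heΦ : A.extend φ ∘ A.c.symm =ᶠ[𝓝 a₀] α₀ := comp_chart_eventuallyEq A.mem_c _
  have hDlim : Tendsto (fun j => fderiv ℝ α (y (σ j))) atTop (𝓝 (fderiv ℝ α₀ a₀)) := by
    rw [← hDα]
    exact (differentiableAt_fderiv_of_contDiffAt hα2).continuousAt.tendsto.comp hyσ
  have hD2lim : Tendsto (fun j => fderiv ℝ (fderiv ℝ α) (y (σ j))) atTop
      (𝓝 (fderiv ℝ (fderiv ℝ α₀) a₀)) := by
    rw [← hD2α]
    exact (((hα2.fderiv_right (m := 1) (by norm_num)).fderiv_right (m := 0)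
      (by norm_num)).continuousAt).tendsto.comp hyσ
  have hΓlim : Tendsto (fun j => christoffelForm g A.c (y (σ j))) atTop
      (𝓝 (christoffelForm g A.c a₀)) := hΓ1.continuousAt.tendsto.comp hyσ
  have hQE : ∀ j (a : Fin n), ‖A.Q (E (y (σ j)) (Fin.castLE hn a))‖ ≤ C * ‖A.Q (y (σ j))‖ :=
    fun j a => (hall j).2.2.1.2 a
  have hQΓ : ∀ j (a b : Fin n), ‖A.Q (christoffelForm g A.c (y (σ j))
      (E (y (σ j)) (Fin.castLE hn a)) (E (y (σ j)) (Fin.castLE hn b)))‖ ≤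
        C' * ‖A.Q (y (σ j))‖ := fun j a b =>
    (hall j).2.2.2.1.2 _ _ ((hall j).2.2.2.2 _) ((hall j).2.2.2.2 _) (hQE j a) (hQE j b)
  -- One bound for every penalty term: two factors of order ‖Q y‖ are absorbed by k‖Q y‖² → 0. It is
  -- used for the pairs (y, E_a), (E_a, E_b) and (y, Γ(E_a, E_b)).
  have hpen : ∀ (v w : ℕ → Euc N) (C₁ C₂ : ℝ), 0 ≤ C₁ →
      (∀ j, ‖A.Q (v j)‖ ≤ C₁ * ‖A.Q (y (σ j))‖) → (∀ j, ‖A.Q (w j)‖ ≤ C₂ * ‖A.Q (y (σ j))‖) →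
      Tendsto (fun j => k (σ j) * (2 * inner ℝ (A.Q (v j)) (A.Q (w j)))) atTop (𝓝 0) := by
    intro v w C₁ C₂ hC₁ hv hw
    refine tendsto_mul_of_abs_le (C := 2 * (C₁ * C₂)) (fun j => hk _) hkσ fun j => ?_
    rw [abs_mul, abs_of_nonneg (by norm_num : (0 : ℝ) ≤ 2)]
    calc 2 * |inner ℝ (A.Q (v j)) (A.Q (w j))| ≤ 2 * (‖A.Q (v j)‖ * ‖A.Q (w j)‖) := by
          gcongr; exact abs_real_inner_le_norm _ _
      _ ≤ 2 * ((C₁ * ‖A.Q (y (σ j))‖) * (C₂ * ‖A.Q (y (σ j))‖)) := by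
          gcongr
          exacts [hv j, hw j]
      _ = _ := by ring
  have hQy : ∀ j, ‖A.Q (y (σ j))‖ ≤ 1 * ‖A.Q (y (σ j))‖ := fun j => by rw [one_mul]
  refine tendsto_jet ?_ (fun a => ?_) (fun a b => ?_)
  · have h1 : Tendsto (fun j => T j (y (σ j))) atTop (𝓝 (α a₀ + 0 + 0)) :=
      ((hα2.continuousAt.tendsto.comp hyσ).add hkσ).add (hc.comp hσt)
    rw [add_zero, add_zero, hαa] at h1
    change Tendsto (fun j => T j (A.c (A.c.symm (y (σ j))))) atTop (𝓝 (α₀ a₀))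
    simpa only [hcy, hα₀a] using h1
  · change Tendsto (fun j => (jetInFrame g (A.c.symm (y (σ j)))
      (fun k => chartDeriv A.c (y (σ j)) (E (y (σ j)) k))
      (jet (T j ∘ A.c) _ (hTc j))).2.1 (Fin.castLE hn a)) atTop (𝓝 ((jetInFrame g (i x)
      (fun k => chartDeriv A.c a₀ (ε k)) (jet (A.extend φ) (i x) _)).2.1 (Fin.castLE hn a)))
    rw [jetInFrame_grad_chart g A.hc A.mem_c (ε := ε) (fun k => rfl), ← ha₀, heΦ.fderiv_eq]
    have h1 : ∀ j, (jetInFrame g (A.c.symm (y (σ j)))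
        (fun k => chartDeriv A.c (y (σ j)) (E (y (σ j)) k))
        (jet (T j ∘ A.c) _ (hTc j))).2.1 (Fin.castLE hn a) =
        fderiv ℝ α (y (σ j)) (E (y (σ j)) (Fin.castLE hn a)) + k (σ j) *
          (2 * inner ℝ (A.Q (y (σ j))) (A.Q (E (y (σ j)) (Fin.castLE hn a)))) := by
      intro j
      rw [jetInFrame_grad_chart g A.hc (hsrc j) (ε := E (y (σ j))) (fun k => by rw [hcy]),
        hcy, (heTc j).fderiv_eq, hDT]
    simp only [h1]
    simpa only [add_zero] using (tendsto_clm_apply hDlim (hεk (Fin.castLE hn a))).add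
      (hpen _ _ 1 C zero_le_one hQy (fun j => hQE j a))
  · change Tendsto (fun j => (jetInFrame g (A.c.symm (y (σ j)))
      (fun k => chartDeriv A.c (y (σ j)) (E (y (σ j)) k))
      (jet (T j ∘ A.c) _ (hTc j))).2.2.1 (Fin.castLE hn a) (Fin.castLE hn b)) atTop
      (𝓝 ((jetInFrame g (i x) (fun k => chartDeriv A.c a₀ (ε k))
        (jet (A.extend φ) (i x) _)).2.2.1 (Fin.castLE hn a) (Fin.castLE hn b)))
    rw [jetInFrame_hess_chart g A.hc A.mem_c (ε := ε) (fun k => rfl), ← ha₀, heΦ.fderiv_eq,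
      heΦ.fderiv.fderiv_eq]
    have h1 : ∀ j, (jetInFrame g (A.c.symm (y (σ j)))
        (fun k => chartDeriv A.c (y (σ j)) (E (y (σ j)) k))
        (jet (T j ∘ A.c) _ (hTc j))).2.2.1 (Fin.castLE hn a) (Fin.castLE hn b) =
        (fderiv ℝ (fderiv ℝ α) (y (σ j)) (E (y (σ j)) (Fin.castLE hn a))
            (E (y (σ j)) (Fin.castLE hn b)) + k (σ j) *
          (2 * inner ℝ (A.Q (E (y (σ j)) (Fin.castLE hn a)))
            (A.Q (E (y (σ j)) (Fin.castLE hn b))))) -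
        (fderiv ℝ α (y (σ j)) (christoffelForm g A.c (y (σ j)) (E (y (σ j)) (Fin.castLE hn a))
            (E (y (σ j)) (Fin.castLE hn b))) + k (σ j) *
          (2 * inner ℝ (A.Q (y (σ j))) (A.Q (christoffelForm g A.c (y (σ j))
            (E (y (σ j)) (Fin.castLE hn a)) (E (y (σ j)) (Fin.castLE hn b)))))) := by
      intro j
      rw [jetInFrame_hess_chart g A.hc (hsrc j) (ε := E (y (σ j))) (fun k => by rw [hcy]),
        hcy, (heTc j).fderiv_eq, (heTc j).fderiv.fderiv_eq, hD2T, hDT]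
    simp only [h1]
    simpa only [add_zero] using
      ((tendsto_clm_apply (tendsto_clm_apply hD2lim (hεk (Fin.castLE hn a)))
        (hεk (Fin.castLE hn b))).add
        (hpen _ _ C C hC (fun j => hQE j a) (fun j => hQE j b))).sub
      ((tendsto_clm_apply hDlim (tendsto_clm_apply (tendsto_clm_apply hΓlim
        (hεk (Fin.castLE hn a))) (hεk (Fin.castLE hn b)))).add
          (hpen _ _ 1 C' zero_le_one hQy (fun j => hQΓ j a b)))

end AdaptedCharts

/-! ### Change of frames -/

section ChangeOfFrame

/-- Expand e' in the basis e: orthonormality of e' says exactly that the coefficient matrix a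
satisfies a aᵗ = 1. -/
theorem exists_orthogonal_of_orthonormal {N : ℕ} {V : Type*} [AddCommGroup V] [Module ℝ V]
    [FiniteDimensional ℝ V]
    (hV : Module.finrank ℝ V = N) (B : V →ₗ[ℝ] V →ₗ[ℝ] ℝ) {e e' : Fin N → V}
    (he : ∀ i j, B (e i) (e j) = if i = j then 1 else 0)
    (he' : ∀ i j, B (e' i) (e' j) = if i = j then 1 else 0) :
    ∃ a : Matrix.orthogonalGroup (Fin N) ℝ,
      ∀ i, e' i = ∑ j, (a : Matrix (Fin N) (Fin N) ℝ) i j • e j := by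
  have hli : LinearIndependent ℝ e := by
    rw [Fintype.linearIndependent_iff]
    intro a ha i
    have h := congrArg (fun v => B v (e i)) ha
    simpa [map_sum, LinearMap.sum_apply, he] using h
  let b : Module.Basis (Fin N) ℝ V := basisOfLinearIndependentOfCardEqFinrank' e hli (by simp [hV])
  have hb : ∀ i, b i = e i := fun i => by simp [b]
  have hrepr : ∀ i, e' i = ∑ j, b.repr (e' i) j • e j := fun i => by
    simp only [← hb]
    exact (b.sum_repr (e' i)).symm
  refine ⟨⟨Matrix.of fun i j => b.repr (e' i) j, ?_⟩, hrepr⟩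
  rw [Matrix.mem_orthogonalGroup_iff]
  ext i j
  have h := he' i j
  rw [hrepr i, hrepr j] at h
  rw [Matrix.one_apply, ← h]
  simp [Matrix.mul_apply, map_sum, LinearMap.sum_apply, he, mul_comm]

variable {N : ℕ} {Z : Type*} [TopologicalSpace Z] [ChartedSpace (Euc N) Z]
  [IsManifold (𝓡 N) ∞ Z] (g : RiemMetric N Z)

/-- A change of frame multiplies the frame matrix on the left, and `Jet.act` is compatible with
products. Invariance of F is used through this identity. -/
theorem jetInFrame_change {z : Z} {e e' : Fin N → TangentSpace (𝓡 N) z}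
    {a : Matrix (Fin N) (Fin N) ℝ} (h : ∀ i, e' i = ∑ j, a i j • e j) (J : Jet N) :
    jetInFrame g z e' J = Jet.act a (jetInFrame g z e J) := by
  have hm : frameMatrix z e' = a * frameMatrix z e := by
    ext i k
    rw [Matrix.mul_apply]
    change (show Euc N from e' i) k = _
    rw [h i]
    have key : ∀ f : Fin N → Euc N, (∑ j, a i j • f j) k = ∑ j, a i j * f j k :=
      fun f => by simp
    exact key e
  simp only [jetInFrame, Jet.act, hm, Matrix.mulVec_mulVec, Matrix.transpose_mul, Matrix.mul_assoc]

theorem exists_orthogonal_of_isOrthonormalFrame {z : Z} {e e' : Fin N → TangentSpace (𝓡 N) z}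
    (he : IsOrthonormalFrame g z e) (he' : IsOrthonormalFrame g z e') :
    ∃ a : Matrix.orthogonalGroup (Fin N) ℝ,
      ∀ i, e' i = ∑ j, (a : Matrix (Fin N) (Fin N) ℝ) i j • e j :=
  let B : Euc N →L[ℝ] Euc N →L[ℝ] ℝ := g.inner z
  exists_orthogonal_of_orthonormal (V := Euc N) (by simp)
    (LinearMap.mk₂ ℝ (fun v w => B v w) (by simp) (by simp) (by simp) (by simp)) he he'

end ChangeOfFrame

theorem jet_congr {n : ℕ} {X : Type*} [TopologicalSpace X] [ChartedSpace (Euc n) X] {φ ψ : X → ℝ}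
    {x : X} (h : φ =ᶠ[𝓝 x] ψ) (hφ : C2At (N := n) φ x) (hψ : C2At (N := n) ψ x) :
    jet φ x hφ = jet ψ x hψ := by
  have h1 : inChart (N := n) φ x =ᶠ[𝓝 (chartAt (Euc n) x x)] inChart ψ x := by
    have h2 := ((chartAt (Euc n) x).continuousAt_symm (mem_chart_target (Euc n) x)).tendsto
    rw [(chartAt (Euc n) x).left_inv (mem_chart_source (Euc n) x)] at h2
    exact h2.eventually h
  refine Prod.ext h.eq_of_nhds (Prod.ext ?_ (Subtype.ext ?_))
  · ext a
    simp only [jet, h1.fderiv_eq]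
  · ext a b
    simp only [jet, h1.fderiv.fderiv_eq]

/-! ### Adapted frames, and the passage from tangential limits to jets on X -/

namespace AdaptedCharts

variable {n N : ℕ} {Z : Type*} [TopologicalSpace Z] [ChartedSpace (Euc N) Z]
  [IsManifold (𝓡 N) ∞ Z] {X : Type*} [TopologicalSpace X] [ChartedSpace (Euc n) X]
  [IsManifold (𝓡 n) ∞ X] {i : X → Z} {x : X} (A : AdaptedCharts n N i x) {g : RiemMetric N Z}

/-- The frame fields `E`, given in the adapted charts near `i x`, are orthonormal, tangent to `X`
up to first order in the distance to `X`, and their limits at `i x` determine `Fs (i x)`. -/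
structure IsAdaptedFrame (hn : n ≤ N) (g : RiemMetric N Z) (F : Set (Jet N)) (Fs : Z → Set (Jet N))
    (E : Euc N → Fin N → Euc N) : Prop where
  orthonormal : ∀ᶠ y in 𝓝 (A.c (i x)), ∀ k l,
    metricForm g A.c y (E y k) (E y l) = if k = l then 1 else 0
  tangent : ∃ C, 0 ≤ C ∧ ∀ᶠ y in 𝓝 (A.c (i x)), ∀ a : Fin n,
    ‖A.Q (E y (Fin.castLE hn a))‖ ≤ C * ‖A.Q y‖
  mem : ∀ᶠ y in 𝓝 (A.c (i x)), ∀ J ∈ Fs (A.c.symm y),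
    jetInFrame g (A.c.symm y) (fun k => chartDeriv A.c y (E y k)) J ∈ F
  mem_of_limit : ∀ (y : ℕ → Euc N) (ε : Fin N → Euc N), Tendsto y atTop (𝓝 (A.c (i x))) →
    Tendsto (fun j => E (y j)) atTop (𝓝 ε) →
    (∀ k l, metricForm g A.c (A.c (i x)) (ε k) (ε l) = if k = l then 1 else 0) →
    ∀ J, jetInFrame g (i x) (fun k => chartDeriv A.c (A.c (i x)) (ε k)) J ∈ F → J ∈ Fs (i x)

/-- The first n limit vectors come from a basis of ℝ^n under ι. Approximants in F are realised as
jets of functions in the limit frame, so their restrictions to X lie in the pulled back fibre, and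
convergence in the frame becomes convergence of jets on X. -/
theorem jet_mem_pullback {hn : n ≤ N} (hgeo : IsTotallyGeodesic (n := n) g i) {F : Set (Jet N)}
    {Fs : Z → Set (Jet N)} {u : Z → EReal} (hu : IsSubharmonic Fs u) {E : Euc N → Fin N → Euc N}
    (hE : A.IsAdaptedFrame hn g F Fs E) {φ : X → ℝ} (hφ : C2At (N := n) φ x)
    (hle : ∀ᶠ y in 𝓝 x, (u ∘ i) y ≤ (φ y : EReal)) (heq : (u ∘ i) x = (φ x : EReal)) :
    jet φ x hφ ∈ closure (pullback (n := n) i Fs x) ∧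
      (IsClosed (Jet.restrict hn '' F) → jet φ x hφ ∈ pullback (n := n) i Fs x) := by
  obtain ⟨C, hC, hEQ⟩ := hE.tangent
  obtain ⟨y, ε, hy, hyε, hεo, hεQ, hK⟩ :=
    A.exists_tangential_limit hn hgeo hu hE.orthonormal hC hEQ hE.mem hφ hle heq
  have hFs := hE.mem_of_limit y ε hy hyε hεo
  have hli := linearIndependent_of_orthonormal g hεo
  have hι : ∀ a : Fin n, ε (Fin.castLE hn a) = A.ι (A.π (ε (Fin.castLE hn a))) :=
    fun a => A.eq_ι_of_Q_eq_zero (hεQ a)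
  have hlit : LinearIndependent ℝ fun a : Fin n => A.π (ε (Fin.castLE hn a)) := by
    refine LinearIndependent.of_comp A.ι.toLinearMap ?_
    have h := hli.comp (Fin.castLE hn) (Fin.castLE_injective hn)
    convert h using 1
    ext1 a
    exact (hι a).symm
  let t : Module.Basis (Fin n) ℝ (Euc n) :=
    basisOfLinearIndependentOfCardEqFinrank' _ hlit (by simp)
  have ht : ∀ a, ε (Fin.castLE hn a) = A.ι (t a) := fun a => by
    rw [hι a]
    simp [t]
  have hreal : ∀ J ∈ F, ∃ (q : Z → ℝ) (hq : C2At (N := N) q (i x)), jetInFrame g (i x)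
      (fun k => chartDeriv A.c (A.c (i x)) (ε k)) (jet q (i x) hq) = J ∧
        jet (q ∘ i) x (A.c2At_comp hq) ∈ pullback (n := n) i Fs x := by
    intro J hJ
    obtain ⟨q, hq, hqJ⟩ := exists_jetInFrame_eq g A.hc A.mem_c
      (e := fun k => chartDeriv A.c (A.c (i x)) (ε k)) (fun k => rfl) hli J
    exact ⟨q, hq, hqJ, q, hq, A.c2At_comp hq, hFs _ (by rw [hqJ]; exact hJ), rfl⟩
  have hjet : jet (A.extend φ ∘ i) x (A.c2At_comp (A.c2At_extend hφ)) = jet φ x hφ :=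
    jet_congr (A.extend_comp_eventuallyEq φ) _ _
  rw [← hjet]
  constructor
  · have : FirstCountableTopology (Matrix (Fin n) (Fin n) ℝ) :=
      inferInstanceAs (FirstCountableTopology (Fin n → Fin n → ℝ))
    have : FirstCountableTopology (SymMat n) :=
      Topology.IsInducing.subtypeVal.firstCountableTopology
    obtain ⟨K, hKF, hKlim⟩ := mem_closure_iff_seq_limit.1 hK
    choose J hJF hJK using hKF
    choose q hq hqJ hqm using fun j => hreal (J j) (hJF j)
    refine mem_closure_of_tendsto (A.tendsto_jet_comp hgeo hn (fun k => rfl) t ht hq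
      (A.c2At_extend hφ) (fun j => A.c2At_comp (hq j)) _ ?_) (Eventually.of_forall hqm)
    simpa only [hqJ, hJK] using hKlim
  · intro hcl
    rw [hcl.closure_eq] at hK
    obtain ⟨J, hJF, hJK⟩ := hK
    obtain ⟨q, hq, hqJ, hqm⟩ := hreal J hJF
    -- For a constant sequence, convergence of jets amounts to equality by uniqueness of limits.
    have h := A.tendsto_jet_comp hgeo hn (e := fun k => chartDeriv A.c (A.c (i x)) (ε k))
      (fun k => rfl) t ht (fun _ => hq)
      (A.c2At_extend hφ) (fun _ => A.c2At_comp hq) (A.c2At_comp (A.c2At_extend hφ))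
      (by rw [hqJ, hJK]; exact tendsto_const_nhds)
    rw [← tendsto_nhds_unique tendsto_const_nhds h]
    exact hqm

end AdaptedCharts

variable {n N : ℕ} {Z : Type*} [TopologicalSpace Z] [ChartedSpace (Euc N) Z]
  [IsManifold (𝓡 N) ∞ Z] {X : Type*} [TopologicalSpace X] [ChartedSpace (Euc n) X]
  [IsManifold (𝓡 n) ∞ X] {i : X → Z} {g : RiemMetric N Z}

theorem restrictionHolds_of_isAdaptedFrame {hn : n ≤ N}
    (hi : Manifold.IsSmoothEmbedding (𝓡 n) (𝓡 N) ∞ i) (hgeo : IsTotallyGeodesic (n := n) g i)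
    {F : Set (Jet N)} {Fs : Z → Set (Jet N)}
    (h : ∀ x (A : AdaptedCharts n N i x), ∃ E, A.IsAdaptedFrame hn g F Fs E) :
    ClosureRestrictionHolds (n := n) i Fs ∧
      (IsClosed (Jet.restrict hn '' F) → RestrictionHolds (n := n) i Fs) := by
  have key : ∀ u : Z → EReal, IsSubharmonic Fs u → ∀ (x : X) (φ : X → ℝ) (hφ : C2At (N := n) φ x),
      (∀ᶠ y in 𝓝 x, (u ∘ i) y ≤ (φ y : EReal)) → (u ∘ i) x = (φ x : EReal) →
      jet φ x hφ ∈ closure (pullback (n := n) i Fs x) ∧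
        (IsClosed (Jet.restrict hn '' F) → jet φ x hφ ∈ pullback (n := n) i Fs x) := by
    intro u hu x φ hφ hle heq
    obtain ⟨A⟩ := exists_adaptedCharts hi x
    obtain ⟨E, hE⟩ := h x A
    exact A.jet_mem_pullback hgeo hu hE hφ hle heq
  have husc : ∀ u : Z → EReal, IsSubharmonic Fs u → UpperSemicontinuous (u ∘ i) :=
    fun u hu => hu.usc.comp hi.isEmbedding.continuous
  exact ⟨fun u hu => ⟨husc u hu, fun x => hu.ne_top _, fun x φ hφ hle heq =>
    (key u hu x φ hφ hle heq).1⟩, fun hcl u hu => ⟨husc u hu, fun x => hu.ne_top _,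
    fun x φ hφ hle heq => (key u hu x φ hφ hle heq).2 hcl⟩⟩

/-! ### Existence of adapted frames -/

namespace AdaptedCharts

variable {x : X} (A : AdaptedCharts n N i x)

theorem isOrthonormalFrame_chartDeriv {c : OpenPartialHomeomorph Z (Euc N)} {y : Euc N}
    (hy : y ∈ c.target) {ε : Fin N → Euc N} :
    IsOrthonormalFrame g (c.symm y) (fun k => chartDeriv c y (ε k)) ↔
      ∀ k l, metricForm g c y (ε k) (ε l) = if k = l then 1 else 0 := by
  have h := isOrthonormalFrame_iff g (c.map_target hy) (e := fun k => chartDeriv c y (ε k)) (ε := ε)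
    (fun k => by rw [c.right_inv hy])
  rwa [c.right_inv hy] at h

omit [IsManifold (𝓡 n) ∞ X] in
-- Choose at each point, with no continuity, an orthonormal basis whose first n vectors lie in the
-- range of ι; the tangency constant is 0. O_N relates any limit frame to every other orthonormal
-- frame, so invariance transfers membership.
theorem exists_isAdaptedFrame_riemannian (hn : n ≤ N) {F : Set (Jet N)}
    (hF : IsUniversalSubequation ⊤ F) :
    ∃ E, A.IsAdaptedFrame hn g F (riemannianSubequation g F) E := by
  have hex : ∀ y, ∃ ε : Fin N → Euc N, y ∈ A.c.target →
      (∀ k l, metricForm g A.c y (ε k) (ε l) = if k = l then 1 else 0) ∧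
        ∀ a : Fin n, A.Q (ε (Fin.castLE hn a)) = 0 := by
    intro y
    by_cases hy : y ∈ A.c.target
    · have hι : Function.Injective A.ι.toLinearMap := fun s t hst => by
        have h := congrArg A.π hst
        simpa only [ContinuousLinearMap.coe_coe, A.π_ι] using h
      obtain ⟨ε, h1, h2⟩ := exists_orthonormal_adapted hn
        (LinearMap.mk₂ ℝ (fun v w => metricForm g A.c y v w) (by simp) (by simp) (by simp)
          (by simp))
        (fun v w => metricForm_symm g A.c y v w) (fun v hv => metricForm_pos g A.hc hy hv)
        (LinearMap.range A.ι.toLinearMap) (by simp)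
        (by rw [LinearMap.finrank_range_of_inj hι]; simp)
      refine ⟨ε, fun _ => ⟨h1, fun a => ?_⟩⟩
      obtain ⟨s, hs⟩ := h2 a
      rw [← hs]
      exact A.Q_ι s
    · exact ⟨0, fun h => absurd h hy⟩
  choose E hE using hex
  have htar : ∀ᶠ y in 𝓝 (A.c (i x)), y ∈ A.c.target :=
    A.c.open_target.mem_nhds (A.c.map_source A.mem_c)
  refine ⟨E, htar.mono fun y hy => (hE y hy).1, ⟨0, le_rfl, htar.mono fun y hy a => ?_⟩,
    htar.mono fun y hy J hJ => hJ _ ((isOrthonormalFrame_chartDeriv hy).2 (hE y hy).1),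
    fun y ε _ _ hε J hJ e he => ?_⟩
  · rw [(hE y hy).2 a, norm_zero, zero_mul]
  · obtain ⟨a, ha⟩ := exists_orthogonal_of_isOrthonormalFrame g
      ((isOrthonormalFrame_iff g A.mem_c (e := fun k => chartDeriv A.c (A.c (i x)) (ε k))
        (fun k => rfl)).2 hε) he
    rw [jetInFrame_change g ha]
    exact hF.act_mem a (Subgroup.mem_top a) _ hJ

end AdaptedCharts

/-! ### Frame fields in charts -/

section FrameField

variable {N : ℕ} {Z : Type*} [TopologicalSpace Z] [ChartedSpace (Euc N) Z]
  [IsManifold (𝓡 N) ∞ Z] {c : OpenPartialHomeomorph Z (Euc N)}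

omit [IsManifold (𝓡 N) ∞ Z] in
theorem mdifferentiable_of_mem_maximalAtlas (hc : c ∈ IsManifold.maximalAtlas (𝓡 N) ∞ Z) :
    c.MDifferentiable (𝓡 N) 𝓘(ℝ, Euc N) :=
  ⟨(contMDiffOn_of_mem_maximalAtlas hc).mdifferentiableOn (by simp),
    (contMDiffOn_symm_of_mem_maximalAtlas hc).mdifferentiableOn (by simp)⟩

/-- The components of a tangent vector in a chart. -/
noncomputable def chartVec (c : OpenPartialHomeomorph Z (Euc N)) (z : Z)
    (v : TangentSpace (𝓡 N) z) : Euc N :=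
  mfderiv (𝓡 N) 𝓘(ℝ, Euc N) c z v

omit [IsManifold (𝓡 N) ∞ Z] in
theorem chartDeriv_chartVec (hc : c ∈ IsManifold.maximalAtlas (𝓡 N) ∞ Z) {z : Z}
    (hz : z ∈ c.source) (v : TangentSpace (𝓡 N) z) : chartDeriv c (c z) (chartVec c z v) = v :=
  DFunLike.congr_fun ((mdifferentiable_of_mem_maximalAtlas hc).symm_comp_deriv hz) v

theorem contDiffOn_chartVec (hc : c ∈ IsManifold.maximalAtlas (𝓡 N) ∞ Z) {s : Set Z}
    {v : (z : Z) → TangentSpace (𝓡 N) z}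
    (hv : ContMDiffOn (𝓡 N) ((𝓡 N).prod 𝓘(ℝ, Euc N)) ∞
      (fun z => (Bundle.TotalSpace.mk z (v z) : TangentBundle (𝓡 N) Z)) s) :
    ContDiffOn ℝ ∞ (fun y => chartVec c (c.symm y) (v (c.symm y))) (c.target ∩ c.symm ⁻¹' s) := by
  have h1 := (contMDiffOn_of_mem_maximalAtlas hc).contMDiffOn_tangentMapWithin
    (m := ∞) (by simp) c.open_source.uniqueMDiffOn
  have h2 : ContMDiffOn 𝓘(ℝ, Euc N) ((𝓡 N).prod 𝓘(ℝ, Euc N)) ∞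
      (fun y => (Bundle.TotalSpace.mk (c.symm y) (v (c.symm y)) : TangentBundle (𝓡 N) Z))
      (c.target ∩ c.symm ⁻¹' s) :=
    hv.comp ((contMDiffOn_symm_of_mem_maximalAtlas hc).mono Set.inter_subset_left) fun y hy => hy.2
  have h3 : ContMDiffOn 𝓘(ℝ, Euc N) 𝓘(ℝ, Euc N).tangent ∞
      (fun y => (⟨y, chartVec c (c.symm y) (v (c.symm y))⟩ :
        TangentBundle 𝓘(ℝ, Euc N) (Euc N))) (c.target ∩ c.symm ⁻¹' s) := by
    refine (h1.comp h2 fun y hy => c.map_target hy.1).congr fun y hy => ?_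
    simp only [Function.comp, tangentMapWithin,
      mfderivWithin_of_isOpen c.open_source (c.map_target hy.1)]
    refine Bundle.TotalSpace.ext (c.right_inv hy.1).symm ?_
    rfl
  exact contMDiffOn_vectorSpace_iff_contDiffOn.1 h3

end FrameField

namespace AdaptedCharts

variable {n N : ℕ} {Z : Type*} [TopologicalSpace Z] [ChartedSpace (Euc N) Z]
  [IsManifold (𝓡 N) ∞ Z] {X : Type*} [TopologicalSpace X] [ChartedSpace (Euc n) X]
  {i : X → Z} {x : X} (A : AdaptedCharts n N i x) {g : RiemMetric N Z}

omit [IsManifold (𝓡 N) ∞ Z] in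
-- Differentiate c ∘ i = ι ∘ d: in adapted charts, tangent vectors to X lie in the range of ι.
theorem Q_chartVec_mfderiv [IsManifold (𝓡 n) ∞ X]
    (hi : Manifold.IsSmoothEmbedding (𝓡 n) (𝓡 N) ∞ i) {w : X}
    (hw : w ∈ A.d.source) (t : TangentSpace (𝓡 n) w) :
    A.Q (chartVec A.c (i w) (mfderiv (𝓡 n) (𝓡 N) i w t)) = 0 := by
  have hd := (mdifferentiable_of_mem_maximalAtlas A.hd).mdifferentiableAt hw
  have hc := (mdifferentiable_of_mem_maximalAtlas A.hc).mdifferentiableAt (A.map_mem w hw)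
  have hiw : MDifferentiableAt (𝓡 n) (𝓡 N) i w := (hi.contMDiff.mdifferentiable (by simp)) w
  have heq : A.c ∘ i =ᶠ[𝓝 w] A.ι ∘ A.d := by
    filter_upwards [A.d.open_source.mem_nhds hw] with y hy
    exact A.map_eq y hy
  have h := heq.mfderiv_eq (I := 𝓡 n) (I' := 𝓘(ℝ, Euc N))
  rw [mfderiv_comp w hc hiw, mfderiv_comp w A.ι.mdifferentiableAt hd,
    ContinuousLinearMap.mfderiv_eq] at h
  have h2 : chartVec A.c (i w) (mfderiv (𝓡 n) (𝓡 N) i w t) =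
      A.ι (mfderiv (𝓡 n) 𝓘(ℝ, Euc n) A.d w t) := DFunLike.congr_fun h t
  exact (congrArg A.Q h2).trans (A.Q_ι _)

/-- E consists of the components of an admissible framing. Its first n fields are tangent along X
and smooth, so their normal parts are O(‖Q y‖). By continuity the limit frame is the framing at i x,
and any other admissible frame there differs by an element of G. -/
theorem exists_isAdaptedFrame_gStructure [IsManifold (𝓡 n) ∞ X] (hn : n ≤ N)
    (hi : Manifold.IsSmoothEmbedding (𝓡 n) (𝓡 N) ∞ i)
    {G : Subgroup (Matrix.orthogonalGroup (Fin N) ℝ)} (S : TopologicalGStructure g G)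
    (hS : IsGSubmanifold (n := n) S i) {F : Set (Jet N)} (hF : IsUniversalSubequation G F) :
    ∃ E, A.IsAdaptedFrame hn g F (gSubequation S F) E := by
  obtain ⟨U, e, hadm, hxU, hadapt⟩ := hS x
  have hfr := S.frameField U e hadm
  set a₀ := A.c (i x) with ha₀
  have ha₀t : a₀ ∈ A.c.target := A.c.map_source A.mem_c
  let E : Euc N → Fin N → Euc N := fun y k => chartVec A.c (A.c.symm y) (e (A.c.symm y) k)
  have hcE : ∀ y ∈ A.c.target, (fun k => chartDeriv A.c y (E y k)) = e (A.c.symm y) := by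
    intro y hy
    funext k
    have h := chartDeriv_chartVec A.hc (A.c.map_target hy) (e (A.c.symm y) k)
    rwa [A.c.right_inv hy] at h
  have hsymm : Tendsto A.c.symm (𝓝 a₀) (𝓝 (i x)) := by
    have h := (A.c.continuousAt_symm ha₀t).tendsto
    rwa [ha₀, A.c.left_inv A.mem_c] at h
  have htar : ∀ᶠ y in 𝓝 a₀, y ∈ A.c.target ∧ A.c.symm y ∈ U :=
    (A.c.open_target.eventually_mem ha₀t).and (hsymm.eventually (U.isOpen.mem_nhds hxU))
  have hE : ∀ k, ContDiffAt ℝ 1 (fun y => E y k) a₀ := fun k =>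
    ((contDiffOn_chartVec A.hc (hfr.smooth k)).contDiffAt htar).of_le ENat.LEInfty.out
  refine ⟨E, ?_, ?_, ?_, ?_⟩
  · filter_upwards [htar] with y hy
    rw [← isOrthonormalFrame_chartDeriv hy.1, hcE y hy.1]
    exact hfr.orthonormal _ hy.2
  · have hC : ∀ a : Fin n, ∃ C, 0 ≤ C ∧ ∀ᶠ y in 𝓝 a₀,
        ‖A.Q (E y (Fin.castLE hn a))‖ ≤ C * ‖A.Q y‖ := by
      intro a
      have hP : Tendsto (fun y => A.ι (A.π y)) (𝓝 a₀) (𝓝 a₀) := by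
        have h := (A.ι.comp A.π).continuous.tendsto a₀
        have h' : (A.ι.comp A.π) a₀ = a₀ := A.ι_π_map_base
        rwa [h'] at h
      refine exists_bound_normal_component (Q := A.Q) (hE (Fin.castLE hn a)) (T := A.Q)
        (P := fun y => A.ι (A.π y)) (by fun_prop) A.ι_π_map_base (fun y => rfl) ?_
      filter_upwards [hP.eventually htar, A.eventually_π_mem] with y hy hy'
      have h1 := A.map_eq _ (A.d.map_target hy')
      rw [A.d.right_inv hy'] at h1
      have h2 : A.c.symm (A.ι (A.π y)) = i (A.d.symm (A.π y)) := by
        rw [← h1]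
        exact A.c.left_inv (A.map_mem _ (A.d.map_target hy'))
      have h3 := hy.2
      simp only [E]
      rw [h2] at h3 ⊢
      obtain ⟨t, ht⟩ := (hadapt _ h3 (Fin.castLE hn a)).1 a.2
      rw [← ht]
      exact A.Q_chartVec_mfderiv hi (A.d.map_target hy') t
    choose C hC0 hC using hC
    -- The sum of the nonnegative constants bounds each of them, giving one constant for all a.
    refine ⟨∑ a, C a, Finset.sum_nonneg fun a _ => hC0 a, ?_⟩
    filter_upwards [eventually_all.2 hC] with y hy a
    refine (hy a).trans ?_
    gcongr
    exact Finset.single_le_sum (f := C) (fun b _ => hC0 b) (Finset.mem_univ a)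
  · filter_upwards [htar] with y hy J hJ
    rw [hcE y hy.1]
    exact hJ U e hadm hy.2
  · intro y ε hy hyε _ J hJ V e' hadm' hxV
    have hcont : Tendsto E (𝓝 a₀) (𝓝 (E a₀)) :=
      tendsto_pi_nhds.2 fun k => (hE k).continuousAt.tendsto
    obtain rfl : ε = E a₀ := tendsto_nhds_unique hyε (hcont.comp hy)
    have h1 : (fun k => chartDeriv A.c a₀ (E a₀ k)) = e (i x) := by
      have key : ∀ z, z = i x → ∀ k, chartVec A.c z (e z k) = chartVec A.c (i x) (e (i x) k) := by
        rintro _ rfl k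
        rfl
      funext k
      simp only [E]
      rw [key _ (A.c.left_inv A.mem_c)]
      exact chartDeriv_chartVec A.hc A.mem_c _
    obtain ⟨a, haG, ha⟩ := S.change U e V e' hadm hadm' (i x) hxU hxV
    rw [jetInFrame_change g ha, ← h1]
    exact hF.act_mem a haG _ hJ

end AdaptedCharts

end Restriction

theorem theorem11p2 {n N : ℕ} (hn : n ≤ N)
    {Z : Type*} [TopologicalSpace Z] [ChartedSpace (Euc N) Z] [IsManifold (𝓡 N) ∞ Z]
    (g : RiemMetric N Z)
    {X : Type*} [TopologicalSpace X] [ChartedSpace (Euc n) X] [IsManifold (𝓡 n) ∞ X]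
    (i : X → Z) (hi : Manifold.IsSmoothEmbedding (𝓡 n) (𝓡 N) ∞ i)
    (hgeo : IsTotallyGeodesic (n := n) g i) (F : Set (Jet N)) :
    (IsUniversalSubequation ⊤ F →
      ClosureRestrictionHolds (n := n) i (riemannianSubequation g F) ∧
      (IsClosed (Jet.restrict hn '' F) →
        RestrictionHolds (n := n) i (riemannianSubequation g F))) ∧
    (∀ (G : Subgroup (Matrix.orthogonalGroup (Fin N) ℝ)) (S : TopologicalGStructure g G),
      IsGSubmanifold (n := n) S i → IsUniversalSubequation G F →
        ClosureRestrictionHolds (n := n) i (gSubequation S F) ∧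
        (IsClosed (Jet.restrict hn '' F) →
          RestrictionHolds (n := n) i (gSubequation S F))) := by
  refine ⟨fun hF => restrictionHolds_of_isAdaptedFrame hi hgeo fun x A =>
    A.exists_isAdaptedFrame_riemannian hn hF, fun G S hS hF =>
    restrictionHolds_of_isAdaptedFrame hi hgeo fun x A =>
      A.exists_isAdaptedFrame_gStructure hn hi S hS hF⟩
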